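/- Let $p\ge 2$ be even and $k\ge 2$. For $a\in[k]^p$ put $f(a)=\sum_{i=1}^k\prod_{j=1}^p\bigl(\mathbf 1_{a_j=i}-\tfrac1k\bigr)$. For $0<\epsilon<\theta_0<\tfrac12$ the $p$-marginal HSBM$(n,k,\theta_0,\epsilon)$ consists of two laws of a random $p$-uniform hypergraph $Y=(Y_S)_{S\in\binom{[n]}{p}}$ on $[n]$: under the null law $\mathbb Q$ the $Y_S$ are independent $\mathrm{Bern}(\theta_0)$; under the planted law $\mathbb P$ one first draws $x\in[k]^n$ uniformly and then, independently for each $S=\{s_1<\dots<s_p\}$, $Y_S\sim\mathrm{Bern}\bigl(\theta_0+\epsilon f(x_{s_1},\dots,x_{s_p})\bigr)$. Let $A_S=(Y_S-\theta_0)/\sqrt{\theta_0(1-\theta_0)}$ and $\beta=\epsilon/\sqrt{\theta_0(1-\theta_0)}$. The $\ell$-th order bosonic Kikuchi matrix $\mathcal K$ is indexed by the $\ell$-tuples of distinct elements of $[n]$. For two such tuples $S,V$ let $S\ominus V$ be the tuple that lists the entries of $S$ at the positions where $S$ and $V$ disagree, followed by those of $V$ at the same positions (both in increasing order of position). Then $\mathcal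 K_{S,V}=A_{\{\mu_1,\dots,\mu_p\}}$ if $S\ominus V=(\mu_1,\dots,\mu_p)$ has length $p$ and distinct entries, and $\mathcal K_{S,V}=0$ otherwise. **Theorem.** There is a constant $C=C_{k,p}>0$ depending only on $k$ and $p$ such that the following holds. Let $\theta_0=\theta_0(n)$, $\epsilon=\epsilon(n)$, $\ell=\ell(n)\in\mathbb N$ satisfy, for all large $n$, $0<\epsilon<\theta_0<\tfrac12$, and, as $n\to\infty$, $$\beta=O(n^{-p/4}),\quad n^{1/2-p/2}=O(\beta),\quad n^{1-p}=O(\theta_0),\quad \ell=o(\sqrt n),\quad \ell\to\infty,$$ and suppose that for all large $n$ $$\beta\ \ge\ \frac{3\sqrt6}{C}\,\ell^{1/2-p/4}\,n^{-p/4}\sqrt{\log n}.$$ With $\tau=\tfrac12 C\beta n^{p/2}\ell^{p/2}$ we have $$\max\Bigl\{\Pr_{\mathbb Q}\bigl[\lambda_{\max}(\mathcal K)\ge\tfrac23\tau\bigr],\ \Pr_{\mathbb P}\bigl[\lambda_{\max}(\mathcal K)\le\tfrac43\tau\bigr]\Bigr\}\longrightarrow 0 .$$ Consequently, estimating $\lambda_{\max}(\mathcal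 K)$ solves hypergraph community detection: if, for all large $n$ and every hypergraph $Y$, the number $\hat\lambda_n(Y)$ satisfies $|\hat\lambda_n(Y)-\lambda_{\max}(\mathcal K)|\le\tfrac13\tau$ or $|\hat\lambda_n(Y)-\lambda_{\max}(\mathcal K)|\le\tfrac14|\lambda_{\max}(\mathcal K)|$, then the test $r$ with $r(Y)=1$ ("random") if $\hat\lambda_n(Y)\le\tau$ and $r(Y)=0$ ("planted") otherwise satisfies $\Pr_{\mathbb Q}[r(Y)=1]\to1$ and $\Pr_{\mathbb P}[r(Y)=0]\to1$. -/

import Mathlib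

open Filter Topology MeasureTheory ProbabilityTheory Asymptotics

namespace HSBM

noncomputable section

/-- The potential hyperedges: the `p`-element subsets of `[n]`. -/
abbrev Hyperedge (n p : ℕ) : Type := {S : Finset (Fin n) // S.card = p}

/-- A `p`-uniform hypergraph on `[n]`, given by its hyperedge indicators `Y_S`. -/
abbrev Hypergraph (n p : ℕ) : Type := Hyperedge n p → Bool

/-- `f(a₁, …, a_p) = ∑ᵢ ∏ⱼ (1_{aⱼ = i} - 1/k)`. -/
def f {k p : ℕ} (a : Fin p → Fin k) : ℝ :=
  ∑ i : Fin k, ∏ j : Fin p, ((if a j = i then (1 : ℝ) else 0) - 1 / (k : ℝ))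

/-- The labels `(x_{s₁}, …, x_{s_p})` of the vertices `s₁ < ⋯ < s_p` of `S`. -/
def restrictLabels {n k p : ℕ} (x : Fin n → Fin k) (S : Hyperedge n p) : Fin p → Fin k :=
  fun j => x (S.1.orderEmbOfFin S.2 j)

/-- `Bern(q)` on `Bool`. The parameter is clamped to `[0, 1]` only to make the definition total;
the clamping is inactive whenever `0 ≤ q ≤ 1`. -/
def bern (q : ℝ) : Measure Bool :=
  bernoulliMeasure true false (Set.projIcc (0 : ℝ) 1 zero_le_one q)

/-- The null law `ℚ`: all hyperedges are independent `Bern(θ₀)`. -/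
def nullLaw (n p : ℕ) (θ₀ : ℝ) : Measure (Hypergraph n p) :=
  Measure.pi fun _ => bern θ₀

/-- The planted law given the labels `x`: the hyperedges are independent
`Bern(θ₀ + ε f(x_S))`. -/
def condLaw (n p : ℕ) {k : ℕ} (θ₀ ε : ℝ) (x : Fin n → Fin k) : Measure (Hypergraph n p) :=
  Measure.pi fun S => bern (θ₀ + ε * f (restrictLabels x S))

/-- The planted law `ℙ`: the mixture of `condLaw` over uniform labels `x ∈ [k]ⁿ`. -/
def plantedLaw (n k p : ℕ) (θ₀ ε : ℝ) : Measure (Hypergraph n p) :=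
  ∑ x : Fin n → Fin k, ((k : ENNReal) ^ n)⁻¹ • condLaw n p θ₀ ε x

/-- The signal-to-noise ratio `β = ε / √(θ₀ (1 - θ₀))`. -/
def snr (θ₀ ε : ℝ) : ℝ := ε / √(θ₀ * (1 - θ₀))

/-- The normalized indicator `A_S = (Y_S - θ₀) / √(θ₀ (1 - θ₀))`. -/
def normalized {n p : ℕ} (θ₀ : ℝ) (Y : Hypergraph n p) (S : Hyperedge n p) : ℝ :=
  ((if Y S then (1 : ℝ) else 0) - θ₀) / √(θ₀ * (1 - θ₀))

/-- The symmetric `p`-tensor of the normalized indicators: its entry at `(μ₁, …, μ_p)` is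
`A_{{μ₁, …, μ_p}}` if the indices are distinct, and `0` otherwise. -/
def tensor {n p : ℕ} (θ₀ : ℝ) (Y : Hypergraph n p) (μ : Fin p → Fin n) : ℝ :=
  if h : Function.Injective μ then
    normalized θ₀ Y ⟨Finset.univ.map ⟨μ, h⟩, by simp⟩
  else 0

/-- The `ℓ`-tuples in `[n]` with no repeated entries. -/
abbrev Tuples (n ℓ : ℕ) : Type := Fin ℓ ↪ Fin n

/-- The positions, in increasing order, at which `S` and `V` disagree. -/
def disagreements {n ℓ : ℕ} (S V : Tuples n ℓ) : List (Fin ℓ) :=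
  (List.finRange ℓ).filter fun a => S a ≠ V a

/-- `S ⊖ V`: the disagreeing entries of `S`, in increasing index order, followed by those of
`V`, in the same order. -/
def ominus {n ℓ : ℕ} (S V : Tuples n ℓ) : List (Fin n) :=
  (disagreements S V).map S ++ (disagreements S V).map V

/-- The `ℓ`-th order bosonic Kikuchi matrix of a `p`-tensor `T`: its entry at `(S, V)` is
`T_{S ⊖ V}` if `S ⊖ V` is a `p`-tuple, and `0` otherwise. -/
def kikuchi {n p : ℕ} (ℓ : ℕ) (T : (Fin p → Fin n) → ℝ) :
    Matrix (Tuples n ℓ) (Tuples n ℓ) ℝ :=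
  fun S V =>
    if h : (ominus S V).length = p then T fun i => (ominus S V).get (i.cast h.symm) else 0

/-- The largest eigenvalue of a real symmetric matrix. -/
def lambdaMax {ι : Type*} [Fintype ι] [DecidableEq ι] (M : Matrix ι ι ℝ) : ℝ :=
  sSup (spectrum ℝ M)

/-- The largest eigenvalue of the `ℓ`-th order bosonic Kikuchi matrix of the hypergraph `Y`. -/
def kikuchiMax {n p : ℕ} (ℓ : ℕ) (θ₀ : ℝ) (Y : Hypergraph n p) : ℝ :=
  lambdaMax (kikuchi ℓ (tensor θ₀ Y))

/-- The threshold `τ = ½ C β n^{p/2} ℓ^{p/2}`. -/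
def threshold (C : ℝ) (n p ℓ : ℕ) (β : ℝ) : ℝ :=
  1 / 2 * C * β * (n : ℝ) ^ ((p : ℝ) / 2) * (ℓ : ℝ) ^ ((p : ℝ) / 2)

/-- The conditions on the parameters `θ₀ = θ₀(n)`, `ε = ε(n)`, `ℓ = ℓ(n)`:
for large `n` they define an HSBM, and
`n^{-p/4} ≳ β ≳ n^{1/2-p/2}`, `θ₀ ≳ n^{1-p}`, `ℓ = o(√n)`, `ℓ = ω(1)`. -/
structure ParamConds (p : ℕ) (θ₀ ε : ℕ → ℝ) (ℓ : ℕ → ℕ) : Prop where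
  theta_pos : ∀ᶠ n in atTop, 0 < θ₀ n
  theta_lt : ∀ᶠ n in atTop, θ₀ n < 1 / 2
  eps_pos : ∀ᶠ n in atTop, 0 < ε n
  eps_lt : ∀ᶠ n in atTop, ε n < θ₀ n
  snr_upper : (fun n => snr (θ₀ n) (ε n)) =O[atTop] fun n : ℕ => (n : ℝ) ^ (-(p : ℝ) / 4)
  snr_lower :
    (fun n : ℕ => (n : ℝ) ^ ((1 : ℝ) / 2 - (p : ℝ) / 2)) =O[atTop] fun n => snr (θ₀ n) (ε n)
  theta_lower : (fun n : ℕ => (n : ℝ) ^ (1 - (p : ℝ))) =O[atTop] θ₀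
  ell_small : (fun n => (ℓ n : ℝ)) =o[atTop] fun n : ℕ => √(n : ℝ)
  ell_large : Tendsto ℓ atTop atTop

/-- A family of tests `r(Y) ∈ {0, 1}` (with `true = 1`) solves hypergraph community detection if
`ℚ[r(Y) = 1] = 1 - o(1)` and `ℙ[r(Y) = 0] = 1 - o(1)`. -/
def SolvesDetection (k p : ℕ) (θ₀ ε : ℕ → ℝ) (r : ∀ n, Hypergraph n p → Bool) : Prop :=
  Tendsto (fun n => (nullLaw n p (θ₀ n)).real {Y | r n Y = true}) atTop (𝓝 1) ∧
  Tendsto (fun n => (plantedLaw n k p (θ₀ n) (ε n)).real {Y | r n Y = false}) atTop (𝓝 1)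

end

end HSBM

namespace HSBM
theorem tensor_congr {n p : ℕ} (θ₀ : ℝ) (Y : Hypergraph n p) (l l' : List (Fin n))
    (h : l.length = p) (h' : l'.length = p) (hp : l.Perm l') :
    tensor θ₀ Y (fun i => l.get (i.cast h.symm)) =
      tensor θ₀ Y (fun i => l'.get (i.cast h'.symm)) := by
  have inj : ∀ (l : List (Fin n)) (h : l.length = p),
      Function.Injective (fun i : Fin p => l.get (i.cast h.symm)) ↔ l.Nodup := by
    intro l h
    subst h
    exact List.nodup_iff_injective_get.symm
  unfold tensor
  by_cases hn : l.Nodup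
  · have hn' := hp.nodup_iff.1 hn
    rw [dif_pos ((inj l h).2 hn), dif_pos ((inj l' h').2 hn')]
    congr 1
    apply Subtype.ext
    ext a
    subst h
    have := hp.mem_iff (a := a)
    simp only [Finset.mem_map, Finset.mem_univ, true_and, Function.Embedding.coeFn_mk]
    rw [List.mem_iff_get, List.mem_iff_get] at this
    constructor
    · rintro ⟨i, hi⟩
      obtain ⟨j, hj⟩ := this.1 ⟨i, hi⟩
      exact ⟨j.cast h', hj⟩
    · rintro ⟨i, hi⟩
      obtain ⟨j, hj⟩ := this.2 ⟨i.cast h'.symm, hi⟩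
      exact ⟨j, hj⟩
  · rw [dif_neg (fun h0 => hn ((inj l h).1 h0)),
      dif_neg (fun h0 => hn (hp.nodup_iff.2 ((inj l' h').1 h0)))]

/-- The Kikuchi matrix of a hypergraph is symmetric. -/
theorem kikuchi_isHermitian {n p : ℕ} (ℓ : ℕ) (θ₀ : ℝ) (Y : Hypergraph n p) :
    (kikuchi ℓ (tensor θ₀ Y)).IsHermitian := by
  ext S V
  have hd : disagreements V S = disagreements S V := by
    simp only [disagreements, ne_comm]
  have hperm : (ominus V S).Perm (ominus S V) := by
    simp only [ominus, hd]
    exact List.perm_append_comm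
  simp only [Matrix.conjTranspose_apply, star_trivial, kikuchi]
  by_cases h : (ominus V S).length = p
  · rw [dif_pos h, dif_pos (hperm.length_eq ▸ h)]
    exact tensor_congr θ₀ Y _ _ h (hperm.length_eq ▸ h) hperm
  · rw [dif_neg h, dif_neg (fun h0 => h (hperm.length_eq.trans h0))]

/-- For a real symmetric matrix of positive size, `lambdaMax` is its largest eigenvalue. -/
theorem isGreatest_lambdaMax {ι : Type*} [Fintype ι] [DecidableEq ι] [Nonempty ι]
    {M : Matrix ι ι ℝ} (hM : M.IsHermitian) : IsGreatest (spectrum ℝ M) (lambdaMax M) := by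
  unfold lambdaMax
  rw [hM.spectrum_real_eq_range_eigenvalues]
  have hf : (Set.range hM.eigenvalues).Finite := Set.finite_range _
  exact ⟨(Set.range_nonempty _).csSup_mem hf, fun x hx => le_csSup hf.bddAbove hx⟩

end HSBM

/-!
Null law: every entry of the Kikuchi matrix is `0` or one of the independent centred weights
`A_S`. A row contains `d = ℓ.choose (p / 2) * (n - ℓ).descFactorial (p / 2)` weights, and each of
them at most `h = (p / 2)!` times. Expand `E tr exp (x K)` over closed walks. A walk continues
either along one of the at most `d` edges with a new label or along one of the at most `h` edges
with a given old label, so the exponential generating function of the moments is a subsolution of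
a linear differential system. An explicit supersolution gives the Bernstein-type bound
`|Tuples| * exp (d / (h B²) * (exp (h B x) - h B x - 1))`, where `B` bounds the weights, and
`|Tuples| ≤ n ^ ℓ` is beaten by the assumed lower bound on `β`.

Planted law: test `K` against the `ℓ`-th tensor power of the vector of signs `labelSign (x s)`. Its
Rayleigh quotient is `d` times the average over the hyperedges `S` of `A_S` multiplied by the signs
of the vertices of `S`. By Chebyshev's inequality this average concentrates around
`β * signalStrength`, which is positive because `p` is even.
-/

namespace HSBM

open scoped Finset Matrix BigOperators Nat

/-! ### Largest eigenvalues of real symmetric matrices -/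

section LambdaMax

variable {ι : Type*} [Fintype ι] [DecidableEq ι]

lemma trace_pow_eq_sum_eigenvalues {𝕜 : Type*} [RCLike 𝕜] {M : Matrix ι ι 𝕜}
    (hM : M.IsHermitian) (r : ℕ) : (M ^ r).trace = ∑ i, (hM.eigenvalues i : 𝕜) ^ r := by
  conv_lhs => rw [hM.spectral_theorem, ← map_pow, Unitary.conjStarAlgAut_apply,
    Matrix.trace_mul_cycle, Matrix.diagonal_pow]
  simp [Matrix.trace]

lemma hasSum_trace_pow {M : Matrix ι ι ℝ} (hM : M.IsHermitian) (x : ℝ) :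
    HasSum (fun r : ℕ => x ^ r / r ! * (M ^ r).trace)
      (∑ i, Real.exp (x * hM.eigenvalues i)) := by
  have hexp (i : ι) : HasSum (fun r : ℕ => (x * hM.eigenvalues i) ^ r / r !)
      (Real.exp (x * hM.eigenvalues i)) := by
    rw [Real.exp_eq_exp_ℝ]
    exact NormedSpace.expSeries_div_hasSum_exp _
  refine (hasSum_sum fun i _ => hexp i).congr_fun fun r => ?_
  rw [trace_pow_eq_sum_eigenvalues hM, Finset.mul_sum]
  exact Finset.sum_congr rfl fun i _ => by simp only [RCLike.ofReal_real_eq_id, id_eq]; ring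

lemma exp_mul_lambdaMax_le_sum [Nonempty ι] {M : Matrix ι ι ℝ} (hM : M.IsHermitian) (x : ℝ) :
    Real.exp (x * lambdaMax M) ≤ ∑ i, Real.exp (x * hM.eigenvalues i) := by
  have hmem := (isGreatest_lambdaMax hM).1
  rw [hM.spectrum_real_eq_range_eigenvalues] at hmem
  obtain ⟨i, hi⟩ := hmem
  rw [← hi]
  exact Finset.single_le_sum (f := fun i => Real.exp (x * hM.eigenvalues i))
    (fun i _ => (Real.exp_pos _).le) (Finset.mem_univ i)

lemma dotProduct_mulVec_le_lambdaMax [Nonempty ι] {M : Matrix ι ι ℝ} (hM : M.IsHermitian)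
    (v : ι → ℝ) : v ⬝ᵥ M *ᵥ v ≤ lambdaMax M * (v ⬝ᵥ v) := by
  have hpos : (algebraMap ℝ (Matrix ι ι ℝ) (lambdaMax M) - M).PosSemidef := by
    rw [Matrix.posSemidef_iff_isHermitian_and_spectrum_nonneg]
    constructor
    · rw [Matrix.algebraMap_eq_diagonal]
      exact (Matrix.isHermitian_diagonal _).sub hM
    · rw [← spectrum.singleton_sub_eq]
      rintro _ ⟨_, rfl, b, hb, rfl⟩
      exact sub_nonneg.2 ((isGreatest_lambdaMax hM).2 hb)
  have hform := hpos.dotProduct_mulVec_nonneg v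
  rw [Algebra.algebraMap_eq_smul_one, Matrix.sub_mulVec, Matrix.smul_mulVec, Matrix.one_mulVec,
    dotProduct_sub, dotProduct_smul, star_trivial, smul_eq_mul] at hform
  linarith

end LambdaMax

/-! ### Random matrices with shared independent entries -/

/-- The matrix whose entry at a pair carrying the label `e` is the weight `A e`, and whose
entry at an unlabelled pair is `0`. -/
def edgeMatrix {ι E : Type*} (edge : ι → ι → Option E) (A : E → ℝ) : Matrix ι ι ℝ :=
  Matrix.of fun T U => (edge T U).elim 0 A

lemma edgeMatrix_isHermitian {ι E : Type*} {edge : ι → ι → Option E}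
    (hedge : ∀ T U, edge T U = edge U T) (A : E → ℝ) : (edgeMatrix edge A).IsHermitian := by
  ext T U
  simp only [edgeMatrix, Matrix.conjTranspose_apply, Matrix.of_apply, hedge U T, star_trivial]

/-- Bound on the absolute `j`-th moment of a centred variable with variance at most `1` and
values in `[-B, B]`. -/
def momentBound (B : ℝ) : ℕ → ℝ
  | 0 => 1
  | 1 => 0
  | j + 2 => B ^ j

/-- The weight at `x` of a label already used `j` times along a walk. It equals
`momentBound B j` at `x = 0` and satisfies `labelGF' (j + 1) = h * labelGF (j + 2)`, where `h`
is the number of ways in which the next step can reuse the label. -/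
noncomputable def labelGF (B h : ℝ) : ℕ → ℝ → ℝ
  | 0, _ => 1
  | 1, x => (Real.exp (h * B * x) - 1) / B
  | j + 2, x => B ^ j * Real.exp (h * B * x)

/-- The bound on the exponential generating function of the moments of walks in a graph of
degree `d`, preceded by `j e` uses of each label `e`. The first factor accounts for the labels
that are still unused. -/
noncomputable def walkGF {E : Type*} [Fintype E] (d B h : ℝ) (j : E → ℕ) (x : ℝ) : ℝ :=
  Real.exp (d / (h * B ^ 2) * (Real.exp (h * B * x) - h * B * x - 1)) *
    ∏ e, labelGF B h (j e) x

section GeneratingFunctions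

variable {d B h x : ℝ}

lemma hasDerivAt_exp_const_mul (c x : ℝ) :
    HasDerivAt (fun y => Real.exp (c * y)) (Real.exp (c * x) * c) x := by
  simpa using ((hasDerivAt_id x).const_mul c).exp

lemma labelGF_zero_right (j : ℕ) : labelGF B h j 0 = momentBound B j := by
  match j with
  | 0 => rfl
  | 1 => simp [labelGF, momentBound]
  | j + 2 => simp [labelGF, momentBound]

lemma labelGF_nonneg (hB : 0 < B) (hh : 0 ≤ h) (hx : 0 ≤ x) (j : ℕ) : 0 ≤ labelGF B h j x := by
  match j with
  | 0 => exact zero_le_one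
  | 1 => exact div_nonneg (sub_nonneg.2 (Real.one_le_exp (by positivity))) hB.le
  | j + 2 => exact mul_nonneg (by positivity) (Real.exp_pos _).le

lemma hasDerivAt_labelGF (hB : B ≠ 0) (j : ℕ) (x : ℝ) :
    HasDerivAt (labelGF B h j) (if j = 0 then 0 else h * labelGF B h (j + 1) x) x := by
  have hexp := hasDerivAt_exp_const_mul (h * B) x
  match j with
  | 0 => exact hasDerivAt_const x 1
  | 1 =>
    refine ((hexp.sub_const 1).div_const B).congr_deriv ?_
    simp only [labelGF, one_ne_zero, if_false, pow_zero, one_mul]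
    field_simp
  | j + 2 =>
    refine (hexp.const_mul (B ^ j)).congr_deriv ?_
    simp only [labelGF, Nat.add_eq_zero_iff, OfNat.ofNat_ne_zero, and_false, if_false]
    ring

variable {E : Type*} [Fintype E]

lemma walkGF_zero_right (j : E → ℕ) : walkGF d B h j 0 = ∏ e, momentBound B (j e) := by
  simp [walkGF, labelGF_zero_right]

lemma walkGF_zero_left :
    walkGF d B h (0 : E → ℕ) x =
      Real.exp (d / (h * B ^ 2) * (Real.exp (h * B * x) - h * B * x - 1)) := by
  simp [walkGF, labelGF]

lemma walkGF_nonneg (hB : 0 < B) (hh : 0 ≤ h) (hx : 0 ≤ x) (j : E → ℕ) :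
    0 ≤ walkGF d B h j x :=
  mul_nonneg (Real.exp_pos _).le (Finset.prod_nonneg fun e _ => labelGF_nonneg hB hh hx (j e))

variable [DecidableEq E]

lemma walkGF_add_single (j : E → ℕ) (e : E) :
    walkGF d B h (j + Pi.single e 1) x =
      Real.exp (d / (h * B ^ 2) * (Real.exp (h * B * x) - h * B * x - 1)) *
        ((∏ e' ∈ Finset.univ.erase e, labelGF B h (j e') x) * labelGF B h (j e + 1) x) := by
  rw [walkGF, ← Finset.prod_erase_mul _ _ (Finset.mem_univ e)]
  congr 2
  · exact Finset.prod_congr rfl fun e' he' => by simp [Finset.ne_of_mem_erase he']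
  · simp

lemma walkGF_add_single_of_eq_zero {j : E → ℕ} {e : E} (he : j e = 0) :
    walkGF d B h (j + Pi.single e 1) x = labelGF B h 1 x * walkGF d B h j x := by
  rw [walkGF_add_single, walkGF, ← Finset.prod_erase_mul _ _ (Finset.mem_univ e), he]
  simp only [labelGF]
  ring

lemma hasDerivAt_walkGF (hB : B ≠ 0) (hh : h ≠ 0) (j : E → ℕ) (x : ℝ) :
    HasDerivAt (walkGF d B h j)
      (d * labelGF B h 1 x * walkGF d B h j x +
        ∑ e with j e ≠ 0, h * walkGF d B h (j + Pi.single e 1) x) x := by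
  have hlin : HasDerivAt (fun y => h * B * y) (h * B) x := by
    simpa using (hasDerivAt_id x).const_mul (h * B)
  have hexp := ((((hasDerivAt_exp_const_mul (h * B) x).sub hlin).sub_const 1).const_mul
    (d / (h * B ^ 2))).exp
  have hprod := HasDerivAt.fun_finsetProd (u := Finset.univ) (x := x)
    fun e _ => hasDerivAt_labelGF (h := h) hB (j e) x
  refine (hexp.mul hprod).congr_deriv (Eq.symm ?_)
  congr 1
  · simp only [walkGF, labelGF, Pi.sub_apply]
    field_simp
  · rw [Finset.mul_sum, Finset.sum_filter]
    refine Finset.sum_congr rfl fun e _ => ?_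
    by_cases he : j e = 0
    · simp [he]
    · rw [if_pos he, if_neg he, walkGF_add_single]
      simp only [smul_eq_mul, Pi.sub_apply]
      ring

lemma sum_walkGF_neighbours_le {ι : Type*} [Fintype ι] (hB : 0 < B) (hh : 0 < h) (hx : 0 ≤ x)
    (neighbour : ι → Option E) (hmult : ∀ e, (#{U | neighbour U = some e} : ℝ) ≤ h)
    (hdeg : (#{U | (neighbour U).isSome} : ℝ) ≤ d) (j : E → ℕ) :
    ∑ U, (neighbour U).elim 0 (fun e => walkGF d B h (j + Pi.single e 1) x) ≤
      d * labelGF B h 1 x * walkGF d B h j x +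
        ∑ e with j e ≠ 0, h * walkGF d B h (j + Pi.single e 1) x := by
  set W : E → ℝ := fun e => walkGF d B h (j + Pi.single e 1) x
  set fresh : ℝ := labelGF B h 1 x * walkGF d B h j x
  have hW (e : E) : 0 ≤ W e := walkGF_nonneg hB hh.le hx _
  have hfresh : 0 ≤ fresh :=
    mul_nonneg (labelGF_nonneg hB hh.le hx 1) (walkGF_nonneg hB hh.le hx j)
  have hsplit (U : ι) : (neighbour U).elim 0 W ≤
      (if (neighbour U).isSome then fresh else 0) +
        ∑ e with j e ≠ 0, if neighbour U = some e then W e else 0 := by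
    cases neighbour U with
    | none => simp
    | some e =>
      simp only [Option.elim_some, Option.isSome_some, if_true, Option.some.injEq,
        Finset.sum_ite_eq, Finset.mem_filter, Finset.mem_univ, true_and]
      by_cases he : j e = 0
      · rw [if_neg (not_not.2 he), add_zero]
        exact (walkGF_add_single_of_eq_zero he).le
      · rw [if_pos he]
        exact le_add_of_nonneg_left hfresh
  calc ∑ U, (neighbour U).elim 0 W
      ≤ ∑ U, ((if (neighbour U).isSome then fresh else 0) +
          ∑ e with j e ≠ 0, if neighbour U = some e then W e else 0) :=
        Finset.sum_le_sum fun U _ => hsplit U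
    _ = #{U | (neighbour U).isSome} * fresh +
          ∑ e with j e ≠ 0, #{U | neighbour U = some e} * W e := by
        rw [Finset.sum_add_distrib, Finset.sum_comm]
        simp only [← Finset.sum_filter, Finset.sum_const, nsmul_eq_mul]
    _ ≤ d * fresh + ∑ e with j e ≠ 0, h * W e :=
        add_le_add (mul_le_mul_of_nonneg_right hdeg hfresh)
          (Finset.sum_le_sum fun e _ => mul_le_mul_of_nonneg_right (hmult e) (hW e))
    _ = _ := by rw [mul_assoc]

end GeneratingFunctions

section WalkMoments

variable {ι E Ω : Type*} [Fintype ι] [DecidableEq ι] [Fintype E] [MeasurableSpace Ω]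

/-- The sum over the endpoints `U` of the absolute expectation of the weights of the walks of
length `r` from `T` to `U`, after `j e` earlier uses of each label `e`. -/
noncomputable def walkMoment (μ : Measure Ω) (edge : ι → ι → Option E) (A : Ω → E → ℝ)
    (r : ℕ) (T : ι) (j : E → ℕ) : ℝ :=
  ∑ U, |∫ ω, (∏ e, A ω e ^ j e) * (edgeMatrix edge (A ω) ^ r) T U ∂μ|

variable {μ : Measure Ω} {edge : ι → ι → Option E} {A : Ω → E → ℝ}

lemma walkMoment_zero (T : ι) (j : E → ℕ) :
    walkMoment μ edge A 0 T j = |∫ ω, ∏ e, A ω e ^ j e ∂μ| := by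
  rw [walkMoment, Finset.sum_eq_single T]
  · simp
  · intro U _ hU
    simp [Matrix.one_apply_ne hU.symm]
  · simp

lemma integral_edgeMatrix_pow_le_walkMoment (r : ℕ) (T : ι) :
    ∫ ω, (edgeMatrix edge (A ω) ^ r) T T ∂μ ≤ walkMoment μ edge A r T 0 :=
  calc ∫ ω, (edgeMatrix edge (A ω) ^ r) T T ∂μ
      ≤ |∫ ω, (∏ e, A ω e ^ (0 : E → ℕ) e) * (edgeMatrix edge (A ω) ^ r) T T ∂μ| := by
        simpa using le_abs_self _
    _ ≤ walkMoment μ edge A r T 0 :=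
        Finset.single_le_sum (f := fun U =>
          |∫ ω, (∏ e, A ω e ^ (0 : E → ℕ) e) * (edgeMatrix edge (A ω) ^ r) T U ∂μ|)
          (fun _ _ => abs_nonneg _) (Finset.mem_univ T)

lemma prod_pow_mul_edgeMatrix_pow_succ [DecidableEq E] (A : E → ℝ) (r : ℕ) (T V : ι)
    (j : E → ℕ) :
    (∏ e, A e ^ j e) * (edgeMatrix edge A ^ (r + 1)) T V =
      ∑ U, (edge T U).elim 0 fun e =>
        (∏ e', A e' ^ (j + Pi.single e 1 : E → ℕ) e') * (edgeMatrix edge A ^ r) U V := by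
  rw [pow_succ', Matrix.mul_apply, Finset.mul_sum]
  refine Finset.sum_congr rfl fun U _ => ?_
  cases hU : edge T U with
  | none => simp [edgeMatrix, hU]
  | some e =>
    have hsingle : ∏ e', A e' ^ (Pi.single e 1 : E → ℕ) e' = A e := by
      rw [Finset.prod_eq_single e (fun b _ hb => by simp [hb]) (by simp)]
      simp
    simp only [edgeMatrix, Matrix.of_apply, hU, Option.elim_some, Pi.add_apply, pow_add,
      Finset.prod_mul_distrib, hsingle]
    ring

variable [Finite Ω] [MeasurableSingletonClass Ω] [IsFiniteMeasure μ]

lemma walkMoment_succ_le [DecidableEq E] (r : ℕ) (T : ι) (j : E → ℕ) :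
    walkMoment μ edge A (r + 1) T j ≤
      ∑ U, (edge T U).elim 0 (fun e => walkMoment μ edge A r U (j + Pi.single e 1)) := by
  set I : ι → ι → E → ℝ := fun U V e =>
    ∫ ω, (∏ e', A ω e' ^ (j + Pi.single e 1 : E → ℕ) e') * (edgeMatrix edge (A ω) ^ r) U V ∂μ
  have hfirst (V : ι) : ∫ ω, (∏ e, A ω e ^ j e) * (edgeMatrix edge (A ω) ^ (r + 1)) T V ∂μ =
      ∑ U, (edge T U).elim 0 (I U V) := by
    simp_rw [prod_pow_mul_edgeMatrix_pow_succ]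
    rw [integral_finsetSum _ fun U _ => Integrable.of_finite]
    refine Finset.sum_congr rfl fun U _ => ?_
    cases edge T U <;> simp [I]
  calc walkMoment μ edge A (r + 1) T j
      = ∑ V, |∑ U, (edge T U).elim 0 (I U V)| := by simp only [walkMoment, hfirst]
    _ ≤ ∑ V, ∑ U, (edge T U).elim 0 fun e => |I U V e| := by
        refine Finset.sum_le_sum fun V _ => (Finset.abs_sum_le_sum_abs _ _).trans_eq ?_
        refine Finset.sum_congr rfl fun U _ => ?_
        cases edge T U <;> simp
    _ = ∑ U, (edge T U).elim 0 (fun e => walkMoment μ edge A r U (j + Pi.single e 1)) := by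
        rw [Finset.sum_comm]
        refine Finset.sum_congr rfl fun U _ => ?_
        cases edge T U <;> simp [walkMoment, I]

lemma sum_walkMoment_succ_le [DecidableEq E] {x : ℝ} (hx : 0 ≤ x) (m : ℕ) (T : ι) (j : E → ℕ) :
    ∑ r ∈ Finset.range m, x ^ r / r ! * walkMoment μ edge A (r + 1) T j ≤
      ∑ U, (edge T U).elim 0 fun e =>
        ∑ r ∈ Finset.range m, x ^ r / r ! * walkMoment μ edge A r U (j + Pi.single e 1) :=
  calc ∑ r ∈ Finset.range m, x ^ r / r ! * walkMoment μ edge A (r + 1) T j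
      ≤ ∑ r ∈ Finset.range m, x ^ r / r ! *
          ∑ U, (edge T U).elim 0 (fun e => walkMoment μ edge A r U (j + Pi.single e 1)) := by
        gcongr
        exact walkMoment_succ_le _ T j
    _ = _ := by
        simp_rw [Finset.mul_sum]
        rw [Finset.sum_comm]
        refine Finset.sum_congr rfl fun U _ => ?_
        cases edge T U <;> simp

lemma hasDerivAt_sum_pow_div_factorial (c : ℕ → ℝ) (m : ℕ) (x : ℝ) :
    HasDerivAt (fun y : ℝ => ∑ r ∈ Finset.range (m + 1), y ^ r / r ! * c r)
      (∑ r ∈ Finset.range m, x ^ r / r ! * c (r + 1)) x := by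
  have hterm : ∀ r ∈ Finset.range (m + 1), HasDerivAt (fun y : ℝ => y ^ r / r ! * c r)
      (r * x ^ (r - 1) / r ! * c r) x :=
    fun r _ => ((hasDerivAt_pow r x).div_const _).mul_const _
  refine (HasDerivAt.fun_sum hterm).congr_deriv ?_
  rw [Finset.sum_range_succ']
  simp only [CharP.cast_eq_zero, zero_mul, zero_div, add_zero]
  refine Finset.sum_congr rfl fun r _ => ?_
  rw [Nat.factorial_succ]
  push_cast
  field_simp

lemma sum_walkMoment_le_walkGF [DecidableEq E] {d B h : ℝ} (hB : 0 < B) (hh : 0 < h)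
    (hmult : ∀ T e, (#{U | edge T U = some e} : ℝ) ≤ h)
    (hdeg : ∀ T, (#{U | (edge T U).isSome} : ℝ) ≤ d)
    (hmom : ∀ j : E → ℕ, |∫ ω, ∏ e, A ω e ^ j e ∂μ| ≤ ∏ e, momentBound B (j e))
    (m : ℕ) (T : ι) (j : E → ℕ) {x : ℝ} (hx : 0 ≤ x) :
    ∑ r ∈ Finset.range m, x ^ r / r ! * walkMoment μ edge A r T j ≤ walkGF d B h j x := by
  induction m generalizing T j x with
  | zero => simpa using walkGF_nonneg hB hh.le hx j
  | succ m ih =>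
    have hinit : ∑ r ∈ Finset.range (m + 1), (0 : ℝ) ^ r / r ! * walkMoment μ edge A r T j ≤
        walkGF d B h j 0 := by
      rw [Finset.sum_range_succ', Finset.sum_eq_zero fun r _ => by simp, walkGF_zero_right]
      simpa [walkMoment_zero] using hmom j
    have hslope (y : ℝ) (hy : 0 ≤ y) :
        ∑ r ∈ Finset.range m, y ^ r / r ! * walkMoment μ edge A (r + 1) T j ≤
          d * labelGF B h 1 y * walkGF d B h j y +
            ∑ e with j e ≠ 0, h * walkGF d B h (j + Pi.single e 1) y :=
      calc _ ≤ _ := sum_walkMoment_succ_le hy m T j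
        _ ≤ ∑ U, (edge T U).elim 0 fun e => walkGF d B h (j + Pi.single e 1) y := by
          refine Finset.sum_le_sum fun U _ => ?_
          cases edge T U with
          | none => exact le_rfl
          | some e => exact ih U _ hy
        _ ≤ _ := sum_walkGF_neighbours_le hB hh hy (edge T) (hmult T) (hdeg T) j
    have hsum (y : ℝ) :=
      hasDerivAt_sum_pow_div_factorial (fun r => walkMoment μ edge A r T j) m y
    have hGF (y : ℝ) := hasDerivAt_walkGF (d := d) hB.ne' hh.ne' j y
    exact image_le_of_deriv_right_le_deriv_boundary
      (fun y _ => (hsum y).continuousAt.continuousWithinAt)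
      (fun y _ => (hsum y).hasDerivWithinAt) hinit
      (fun y _ => (hGF y).continuousAt.continuousWithinAt)
      (fun y _ => (hGF y).hasDerivWithinAt) (fun y hy => hslope y hy.1)
      (Set.right_mem_Icc.2 hx)

end WalkMoments

section SpectralTail

variable {ι E Ω : Type*} [Fintype ι] [DecidableEq ι] [Fintype E] [DecidableEq E]
  [MeasurableSpace Ω] [Finite Ω] [MeasurableSingletonClass Ω]
  {μ : Measure Ω} [IsFiniteMeasure μ] {edge : ι → ι → Option E} {A : Ω → E → ℝ} {d B h : ℝ}

lemma sum_integral_trace_pow_le (hB : 0 < B) (hh : 0 < h)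
    (hmult : ∀ T e, (#{U | edge T U = some e} : ℝ) ≤ h)
    (hdeg : ∀ T, (#{U | (edge T U).isSome} : ℝ) ≤ d)
    (hmom : ∀ j : E → ℕ, |∫ ω, ∏ e, A ω e ^ j e ∂μ| ≤ ∏ e, momentBound B (j e))
    {x : ℝ} (hx : 0 ≤ x) (m : ℕ) :
    ∑ r ∈ Finset.range m, x ^ r / r ! * ∫ ω, (edgeMatrix edge (A ω) ^ r).trace ∂μ ≤
      Fintype.card ι *
        Real.exp (d / (h * B ^ 2) * (Real.exp (h * B * x) - h * B * x - 1)) :=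
  calc ∑ r ∈ Finset.range m, x ^ r / r ! * ∫ ω, (edgeMatrix edge (A ω) ^ r).trace ∂μ
      = ∑ r ∈ Finset.range m, x ^ r / r ! *
          ∑ T, ∫ ω, (edgeMatrix edge (A ω) ^ r) T T ∂μ := by
        simp only [Matrix.trace, Matrix.diag_apply]
        simp_rw [integral_finsetSum _ fun _ _ => Integrable.of_finite]
    _ ≤ ∑ r ∈ Finset.range m, x ^ r / r ! * ∑ T, walkMoment μ edge A r T 0 := by
        gcongr
        exact integral_edgeMatrix_pow_le_walkMoment _ _
    _ = ∑ T, ∑ r ∈ Finset.range m, x ^ r / r ! * walkMoment μ edge A r T 0 := by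
        simp_rw [Finset.mul_sum]
        exact Finset.sum_comm
    _ ≤ ∑ _T : ι, walkGF d B h (0 : E → ℕ) x :=
        Finset.sum_le_sum fun T _ => sum_walkMoment_le_walkGF hB hh hmult hdeg hmom m T 0 hx
    _ = _ := by rw [walkGF_zero_left, Finset.sum_const, nsmul_eq_mul, Finset.card_univ]

lemma integral_exp_lambdaMax_edgeMatrix_le [Nonempty ι] (hB : 0 < B) (hh : 0 < h)
    (hedge : ∀ T U, edge T U = edge U T)
    (hmult : ∀ T e, (#{U | edge T U = some e} : ℝ) ≤ h)
    (hdeg : ∀ T, (#{U | (edge T U).isSome} : ℝ) ≤ d)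
    (hmom : ∀ j : E → ℕ, |∫ ω, ∏ e, A ω e ^ j e ∂μ| ≤ ∏ e, momentBound B (j e))
    {x : ℝ} (hx : 0 ≤ x) :
    ∫ ω, Real.exp (x * lambdaMax (edgeMatrix edge (A ω))) ∂μ ≤
      Fintype.card ι *
        Real.exp (d / (h * B ^ 2) * (Real.exp (h * B * x) - h * B * x - 1)) := by
  have hsymm (ω : Ω) := edgeMatrix_isHermitian hedge (A ω)
  have hlim : Tendsto (fun m => ∑ r ∈ Finset.range m,
      x ^ r / r ! * ∫ ω, (edgeMatrix edge (A ω) ^ r).trace ∂μ) atTop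
      (𝓝 (∫ ω, ∑ i, Real.exp (x * (hsymm ω).eigenvalues i) ∂μ)) := by
    cases nonempty_fintype Ω
    simp_rw [← integral_const_mul]
    simp_rw [← integral_finsetSum _ fun _ _ => Integrable.of_finite]
    simp_rw [integral_fintype Integrable.of_finite]
    exact tendsto_finsetSum _ fun ω _ =>
      ((hasSum_trace_pow (hsymm ω) x).tendsto_sum_nat).const_smul _
  calc ∫ ω, Real.exp (x * lambdaMax (edgeMatrix edge (A ω))) ∂μ
      ≤ ∫ ω, ∑ i, Real.exp (x * (hsymm ω).eigenvalues i) ∂μ :=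
        integral_mono Integrable.of_finite Integrable.of_finite fun ω =>
          exp_mul_lambdaMax_le_sum (hsymm ω) x
    _ ≤ _ := le_of_tendsto' hlim (sum_integral_trace_pow_le hB hh hmult hdeg hmom hx)

theorem measureReal_lambdaMax_edgeMatrix_ge_le [Nonempty ι] (hB : 0 < B) (hh : 0 < h)
    (hedge : ∀ T U, edge T U = edge U T)
    (hmult : ∀ T e, (#{U | edge T U = some e} : ℝ) ≤ h)
    (hdeg : ∀ T, (#{U | (edge T U).isSome} : ℝ) ≤ d)
    (hmom : ∀ j : E → ℕ, |∫ ω, ∏ e, A ω e ^ j e ∂μ| ≤ ∏ e, momentBound B (j e))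
    {σ t : ℝ} (hσ : d * h ≤ σ) (ht : 0 < t) (htσ : h * B * t ≤ 2 * σ) :
    μ.real {ω | t ≤ lambdaMax (edgeMatrix edge (A ω))} ≤
      Fintype.card ι * Real.exp (-(t ^ 2 / (4 * σ))) := by
  have hσ0 : 0 < σ := by
    have : 0 < h * B * t := by positivity
    linarith
  -- Minimizer of the exponent `σ * x ^ 2 - t * x`.
  set x := t / (2 * σ)
  have hx : 0 ≤ x := by positivity
  have hu : |h * B * x| ≤ 1 := by
    rw [abs_of_nonneg (by positivity), mul_div_assoc', div_le_one (by positivity)]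
    exact htσ
  have hexponent : d / (h * B ^ 2) * (Real.exp (h * B * x) - h * B * x - 1) ≤ σ * x ^ 2 := by
    have hd : 0 ≤ d := by
      obtain ⟨T⟩ := ‹Nonempty ι›
      exact (Nat.cast_nonneg _).trans (hdeg T)
    calc d / (h * B ^ 2) * (Real.exp (h * B * x) - h * B * x - 1)
        ≤ d / (h * B ^ 2) * (h * B * x) ^ 2 := by
          gcongr
          have := (abs_le.1 (Real.abs_exp_sub_one_sub_id_le hu)).2
          linarith
      _ = d * h * x ^ 2 := by field_simp
      _ ≤ σ * x ^ 2 := by gcongr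
  calc μ.real {ω | t ≤ lambdaMax (edgeMatrix edge (A ω))}
      ≤ Real.exp (-x * t) * ∫ ω, Real.exp (x * lambdaMax (edgeMatrix edge (A ω))) ∂μ :=
        measure_ge_le_exp_mul_mgf t hx Integrable.of_finite
    _ ≤ Real.exp (-x * t) * (Fintype.card ι * Real.exp (σ * x ^ 2)) := by
        gcongr
        refine (integral_exp_lambdaMax_edgeMatrix_le hB hh hedge hmult hdeg hmom hx).trans ?_
        gcongr
    _ = Fintype.card ι * Real.exp (-(t ^ 2 / (4 * σ))) := by
        rw [mul_left_comm, ← Real.exp_add]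
        congr 2
        simp only [x]
        field_simp
        ring

end SpectralTail

section Moments

variable {Ω : Type*} [MeasurableSpace Ω] [Finite Ω] [MeasurableSingletonClass Ω]
  {μ : Measure Ω} [IsProbabilityMeasure μ]

lemma abs_integral_pow_le_momentBound {X : Ω → ℝ} {B : ℝ} (hmean : ∫ ω, X ω ∂μ = 0)
    (hvar : ∫ ω, X ω ^ 2 ∂μ ≤ 1) (hB : ∀ ω, |X ω| ≤ B) (j : ℕ) :
    |∫ ω, X ω ^ j ∂μ| ≤ momentBound B j := by
  match j with
  | 0 => simp [momentBound]
  | 1 => simp [momentBound, hmean]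
  | j + 2 =>
    have hB0 : 0 ≤ B := by
      obtain ⟨ω⟩ := μ.nonempty_of_neZero
      exact (abs_nonneg _).trans (hB ω)
    calc |∫ ω, X ω ^ (j + 2) ∂μ| ≤ ∫ ω, |X ω ^ (j + 2)| ∂μ := abs_integral_le_integral_abs
      _ ≤ ∫ ω, B ^ j * X ω ^ 2 ∂μ := by
          refine integral_mono Integrable.of_finite Integrable.of_finite fun ω => ?_
          simp only [pow_add, abs_mul, abs_pow, sq_abs]
          gcongr
          exact hB ω
      _ ≤ B ^ j := by
          rw [integral_const_mul]
          exact mul_le_of_le_one_right (by positivity) hvar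

end Moments

/-! ### Hyperedges labelling the entries of the Kikuchi matrix -/

section Labels

variable {n ℓ p q : ℕ} {T U : Tuples n ℓ}

/-- The set of positions at which two tuples disagree. -/
def diffSet (T U : Tuples n ℓ) : Finset (Fin ℓ) := {a | T a ≠ U a}

/-- `U` arises from `T` by replacing some entries by vertices that do not occur in `T`;
equivalently `T ⊖ U` has no repeated entry. -/
def IsReplacement (T U : Tuples n ℓ) : Prop := ∀ a, T a ≠ U a → ∀ b, T b ≠ U a

lemma mem_diffSet {a : Fin ℓ} : a ∈ diffSet T U ↔ T a ≠ U a := by simp [diffSet]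

lemma eq_of_notMem_diffSet {a : Fin ℓ} (ha : a ∉ diffSet T U) : T a = U a :=
  not_not.1 (mt mem_diffSet.2 ha)

lemma disagreements_nodup (T U : Tuples n ℓ) : (disagreements T U).Nodup :=
  (List.nodup_finRange ℓ).filter _

lemma mem_disagreements {a : Fin ℓ} : a ∈ disagreements T U ↔ T a ≠ U a := by
  simp [disagreements]

lemma toFinset_disagreements (T U : Tuples n ℓ) : (disagreements T U).toFinset = diffSet T U := by
  ext a
  rw [List.mem_toFinset, mem_disagreements, mem_diffSet]

lemma length_ominus (T U : Tuples n ℓ) : (ominus T U).length = 2 * #(diffSet T U) := by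
  rw [← toFinset_disagreements, List.toFinset_card_of_nodup (disagreements_nodup T U), ominus,
    List.length_append, List.length_map, List.length_map, two_mul]

lemma mem_ominus {s : Fin n} : s ∈ ominus T U ↔ ∃ a, T a ≠ U a ∧ (s = T a ∨ s = U a) := by
  simp only [ominus, List.mem_append, List.mem_map, mem_disagreements, ← exists_or, ← and_or_left,
    eq_comm]

lemma nodup_ominus_iff : (ominus T U).Nodup ↔ IsReplacement T U := by
  rw [ominus, List.nodup_append, and_iff_right ((disagreements_nodup T U).map T.injective),
    and_iff_right ((disagreements_nodup T U).map U.injective)]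
  simp only [List.mem_map, mem_disagreements]
  constructor
  · intro hdisjoint a ha b hba
    by_cases hb : T b = U b
    · exact ha (by rw [← hba, U.injective (hb.symm.trans hba)])
    · exact hdisjoint (T b) ⟨b, hb, rfl⟩ (U a) ⟨a, ha, rfl⟩ hba
  · rintro hU _ ⟨b, -, rfl⟩ _ ⟨a, ha, rfl⟩
    exact hU a ha b

/-- The hyperedge `T ⊖ U`, if its `p` entries are distinct. -/
def edgeOf (p : ℕ) (T U : Tuples n ℓ) : Option (Hyperedge n p) :=
  if h : (ominus T U).length = p ∧ (ominus T U).Nodup then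
    some ⟨(ominus T U).toFinset, by rw [List.toFinset_card_of_nodup h.2, h.1]⟩
  else none

lemma edgeOf_eq_some {S : Hyperedge n p} :
    edgeOf p T U = some S ↔
      (ominus T U).length = p ∧ (ominus T U).Nodup ∧ (ominus T U).toFinset = S.1 := by
  unfold edgeOf
  split_ifs with h
  · simp [h.1, h.2, Subtype.ext_iff]
  · simp only [false_iff]
    tauto

lemma edgeOf_eq_some_iff {S : Hyperedge n p} :
    edgeOf p T U = some S ↔ 2 * #(diffSet T U) = p ∧ IsReplacement T U ∧
      ∀ s, s ∈ S.1 ↔ ∃ a, T a ≠ U a ∧ (s = T a ∨ s = U a) := by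
  simp only [edgeOf_eq_some, length_ominus, nodup_ominus_iff, Finset.ext_iff, List.mem_toFinset,
    mem_ominus, iff_comm]

lemma edgeOf_isSome : (edgeOf p T U).isSome ↔ 2 * #(diffSet T U) = p ∧ IsReplacement T U := by
  rw [← length_ominus, ← nodup_ominus_iff]
  unfold edgeOf
  split_ifs with h <;> simpa using h

lemma edgeOf_comm (p : ℕ) (T U : Tuples n ℓ) : edgeOf p T U = edgeOf p U T := by
  have hperm : (ominus T U).Perm (ominus U T) := by
    have : disagreements U T = disagreements T U := by simp only [disagreements, ne_comm]
    simp only [ominus, this]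
    exact List.perm_append_comm
  ext S
  rw [edgeOf_eq_some, edgeOf_eq_some, hperm.length_eq, hperm.nodup_iff,
    List.toFinset_eq_of_perm _ _ hperm]

lemma tensor_eq_normalized {θ₀ : ℝ} {Y : Hypergraph n p} {l : List (Fin n)} (hl : l.length = p)
    (hnodup : l.Nodup) :
    tensor θ₀ Y (fun i => l.get (i.cast hl.symm)) =
      normalized θ₀ Y ⟨l.toFinset, by rw [List.toFinset_card_of_nodup hnodup, hl]⟩ := by
  subst hl
  refine (dif_pos (List.nodup_iff_injective_get.1 hnodup)).trans ?_
  congr 2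
  ext s
  simp only [Finset.mem_map, Finset.mem_univ, true_and, Function.Embedding.coeFn_mk,
    List.mem_toFinset, List.mem_iff_get]
  rfl

lemma tensor_eq_zero {θ₀ : ℝ} {Y : Hypergraph n p} {l : List (Fin n)} (hl : l.length = p)
    (hdup : ¬ l.Nodup) : tensor θ₀ Y (fun i => l.get (i.cast hl.symm)) = 0 := by
  subst hl
  exact dif_neg (mt List.nodup_iff_injective_get.2 hdup)

lemma kikuchi_tensor_eq_edgeMatrix (θ₀ : ℝ) (Y : Hypergraph n p) :
    kikuchi ℓ (tensor θ₀ Y) = edgeMatrix (edgeOf p) (normalized θ₀ Y) := by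
  ext T U
  simp only [kikuchi, edgeMatrix, Matrix.of_apply, edgeOf]
  by_cases hlen : (ominus T U).length = p
  · rw [dif_pos hlen]
    by_cases hnodup : (ominus T U).Nodup
    · rw [dif_pos ⟨hlen, hnodup⟩, Option.elim_some, tensor_eq_normalized hlen hnodup]
    · rw [dif_neg (mt And.right hnodup), Option.elim_none, tensor_eq_zero hlen hnodup]
  · rw [dif_neg hlen, dif_neg (mt And.left hlen), Option.elim_none]

/-! ### Multiplicities and degrees of the labels -/

lemma diffSet_eq_of_edgeOf {S : Hyperedge n p} (hU : edgeOf p T U = some S) :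
    diffSet T U = ({a | T a ∈ S.1} : Finset (Fin ℓ)) := by
  obtain ⟨-, hrep, hS⟩ := edgeOf_eq_some_iff.1 hU
  ext a
  rw [mem_diffSet, Finset.mem_filter_univ, hS]
  constructor
  · exact fun ha => ⟨a, ha, Or.inl rfl⟩
  · rintro ⟨b, hb, hab | hab⟩
    · rwa [T.injective hab]
    · exact absurd hab (hrep b hb a)

lemma apply_mem_sdiff_of_edgeOf {S : Hyperedge n p} (hU : edgeOf p T U = some S) {a : Fin ℓ}
    (ha : T a ∈ S.1) : U a ∈ S.1 \ Finset.univ.map T := by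
  obtain ⟨-, hrep, hS⟩ := edgeOf_eq_some_iff.1 hU
  have hne : T a ≠ U a := by
    rw [← mem_diffSet, diffSet_eq_of_edgeOf hU]
    exact Finset.mem_filter_univ _ |>.2 ha
  rw [Finset.mem_sdiff]
  refine ⟨(hS _).2 ⟨a, hne, Or.inr rfl⟩, fun hmem => ?_⟩
  obtain ⟨b, -, hb⟩ := Finset.mem_map.1 hmem
  exact hrep a hne b hb

lemma card_filter_apply_mem_add_card_sdiff (T : Tuples n ℓ) (S : Finset (Fin n)) :
    #{a | T a ∈ S} + #(S \ Finset.univ.map T) = #S := by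
  have hinter : ({a | T a ∈ S} : Finset (Fin ℓ)).map T = S ∩ Finset.univ.map T := by
    ext s
    simp only [Finset.mem_map, Finset.mem_filter_univ, Finset.mem_inter, Finset.mem_univ,
      true_and]
    constructor
    · rintro ⟨a, ha, rfl⟩
      exact ⟨ha, a, rfl⟩
    · rintro ⟨hs, a, rfl⟩
      exact ⟨a, hs, rfl⟩
  rw [← Finset.card_map T, hinter, Finset.card_inter_add_card_sdiff]

lemma card_filter_edgeOf_eq_some_le (T : Tuples n ℓ) (S : Hyperedge n (2 * q)) :
    #{U | edgeOf (2 * q) T U = some S} ≤ q ! := by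
  rcases ({U | edgeOf (2 * q) T U = some S} : Finset _).eq_empty_or_nonempty with
    hempty | ⟨U₀, hU₀⟩
  · simp [hempty]
  have hD : #{a | T a ∈ S.1} = q := by
    have hU₀ := (Finset.mem_filter_univ _).1 hU₀
    have := (edgeOf_eq_some_iff.1 hU₀).1
    rw [diffSet_eq_of_edgeOf hU₀] at this
    omega
  have hR : #(S.1 \ Finset.univ.map T) = q := by
    have := card_filter_apply_mem_add_card_sdiff T S.1
    have := S.2
    omega
  let restriction (U : {U // edgeOf (2 * q) T U = some S}) :
      {a // T a ∈ S.1} ↪ ↥(S.1 \ Finset.univ.map T) :=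
    ⟨fun a => ⟨U.1 a, apply_mem_sdiff_of_edgeOf U.2 a.2⟩,
      fun a b hab => Subtype.ext (U.1.injective (congrArg Subtype.val hab))⟩
  have hinj : Function.Injective restriction := by
    intro U V hUV
    ext1
    ext1 a
    by_cases ha : T a ∈ S.1
    · exact congrArg Subtype.val (DFunLike.congr_fun hUV ⟨a, ha⟩)
    · have hfix (W : {W // edgeOf (2 * q) T W = some S}) : T a = W.1 a :=
        eq_of_notMem_diffSet (by rwa [diffSet_eq_of_edgeOf W.2, Finset.mem_filter_univ])
      rw [← hfix U, ← hfix V]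
  have hcard := Fintype.card_le_of_injective restriction hinj
  rwa [Fintype.card_subtype, Fintype.card_embedding_eq, Fintype.card_coe, Fintype.card_subtype,
    hD, hR, Nat.descFactorial_self] at hcard

/-- The tuple obtained from `T` by replacing its entries at the positions in `D` by the distinct
vertices prescribed by `e`, none of which occurs in `T`. -/
def replaceTuple (T : Tuples n ℓ) (D : Finset (Fin ℓ)) (e : D ↪ {s // s ∉ Finset.univ.map T}) :
    Tuples n ℓ :=
  ⟨fun a => if h : a ∈ D then (e ⟨a, h⟩).1 else T a, by
    have hnew (a : D) (b : Fin ℓ) : (e a).1 ≠ T b := fun h =>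
      (e a).2 (h ▸ Finset.mem_map_of_mem T (Finset.mem_univ b))
    intro a b hab
    by_cases ha : a ∈ D <;> by_cases hb : b ∈ D <;>
      simp only [ha, hb, dif_pos, dif_neg, not_false_iff] at hab
    · simpa using e.injective (Subtype.ext hab)
    · exact absurd hab (hnew _ _)
    · exact absurd hab.symm (hnew _ _)
    · exact T.injective hab⟩

section Replace

variable {D : Finset (Fin ℓ)} (e : D ↪ {s // s ∉ Finset.univ.map T})

lemma replaceTuple_of_mem {a : Fin ℓ} (h : a ∈ D) : replaceTuple T D e a = (e ⟨a, h⟩).1 :=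
  dif_pos h

lemma replaceTuple_of_notMem {a : Fin ℓ} (h : a ∉ D) : replaceTuple T D e a = T a :=
  dif_neg h

lemma apply_ne_replaceTuple {a : Fin ℓ} (h : a ∈ D) (b : Fin ℓ) : T b ≠ replaceTuple T D e a := by
  rw [replaceTuple_of_mem e h]
  exact fun hb => (e ⟨a, h⟩).2 (hb ▸ Finset.mem_map_of_mem T (Finset.mem_univ b))

lemma diffSet_replaceTuple : diffSet T (replaceTuple T D e) = D := by
  ext a
  rw [mem_diffSet]
  by_cases ha : a ∈ D
  · exact iff_of_true (apply_ne_replaceTuple e ha a) ha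
  · exact iff_of_false (not_not.2 (replaceTuple_of_notMem e ha).symm) ha

lemma isReplacement_replaceTuple : IsReplacement T (replaceTuple T D e) := by
  intro a ha b
  rw [← mem_diffSet, diffSet_replaceTuple] at ha
  exact apply_ne_replaceTuple e ha b

end Replace

/-- The replacements of `T` that differ from `T` exactly at the positions in `D` correspond to the
injections of `D` into the vertices that do not occur in `T`. -/
def replacementEquiv (T : Tuples n ℓ) (D : Finset (Fin ℓ)) :
    {U : Tuples n ℓ // diffSet T U = D ∧ IsReplacement T U} ≃
      (D ↪ {s // s ∉ Finset.univ.map T}) where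
  toFun U :=
    ⟨fun a => ⟨U.1 a, fun hmem => by
      obtain ⟨b, -, hb⟩ := Finset.mem_map.1 hmem
      exact U.2.2 a (mem_diffSet.1 (U.2.1.symm.subset a.2)) b hb⟩,
      fun a b hab => Subtype.ext (U.1.injective (by simpa using hab))⟩
  invFun e := ⟨replaceTuple T D e, diffSet_replaceTuple e, isReplacement_replaceTuple e⟩
  left_inv U := by
    ext1
    ext1 a
    by_cases ha : a ∈ D
    · exact replaceTuple_of_mem _ ha
    · exact (replaceTuple_of_notMem _ ha).trans (eq_of_notMem_diffSet (U.2.1.symm ▸ ha))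
  right_inv e := by
    ext1 a
    exact Subtype.ext (replaceTuple_of_mem e a.2)

/-- The degree of the graph whose edges are the pairs of tuples carrying a label: choose the
`q` positions to replace and then their new entries. -/
def kikuchiDegree (n ℓ q : ℕ) : ℕ := ℓ.choose q * (n - ℓ).descFactorial q

lemma card_filter_edgeOf_isSome (T : Tuples n ℓ) :
    #{U | (edgeOf (2 * q) T U).isSome} = kikuchiDegree n ℓ q := by
  classical
  have hfibre (D : Finset (Fin ℓ)) (hD : D ∈ Finset.powersetCard q Finset.univ) :
      #{U ∈ ({U | (edgeOf (2 * q) T U).isSome} : Finset _) | diffSet T U = D} =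
        (n - ℓ).descFactorial q := by
    have hDcard : #D = q := (Finset.mem_powersetCard.1 hD).2
    have hcard := Fintype.card_congr (replacementEquiv T D)
    rw [Fintype.card_subtype, Fintype.card_embedding_eq, Fintype.card_coe, hDcard,
      Fintype.card_subtype_compl, Fintype.card_coe, Finset.card_map, Finset.card_univ,
      Fintype.card_fin, Fintype.card_fin] at hcard
    rw [← hcard, Finset.filter_filter]
    congr 1
    ext U
    simp only [Finset.mem_filter_univ, edgeOf_isSome]
    constructor
    · exact fun ⟨⟨_, hrep⟩, hdiff⟩ => ⟨hdiff, hrep⟩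
    · exact fun ⟨hdiff, hrep⟩ => ⟨⟨by rw [hdiff, hDcard], hrep⟩, hdiff⟩
  have hmaps (U : Tuples n ℓ) (hU : U ∈ ({U | (edgeOf (2 * q) T U).isSome} : Finset _)) :
      diffSet T U ∈ Finset.powersetCard q Finset.univ := by
    have := (edgeOf_isSome.1 (Finset.mem_filter.1 hU).2).1
    exact Finset.mem_powersetCard.2 ⟨Finset.subset_univ _, by omega⟩
  rw [Finset.card_eq_sum_card_fiberwise hmaps, Finset.sum_congr rfl hfibre, Finset.sum_const,
    Finset.card_powersetCard, Finset.card_univ, Fintype.card_fin, smul_eq_mul, kikuchiDegree]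

lemma edgeOf_trans_perm (π : Equiv.Perm (Fin n)) {S S' : Hyperedge n p}
    (hS : ∀ s, π s ∈ S'.1 ↔ s ∈ S.1) :
    edgeOf p (T.trans π.toEmbedding) (U.trans π.toEmbedding) = some S' ↔
      edgeOf p T U = some S := by
  have hdiff : diffSet (T.trans π.toEmbedding) (U.trans π.toEmbedding) = diffSet T U := by
    ext a
    simp [mem_diffSet]
  rw [edgeOf_eq_some_iff, edgeOf_eq_some_iff, hdiff, ← π.forall_congr_right]
  simp [IsReplacement, hS]

lemma card_pairs_edgeOf_eq (S S' : Hyperedge n p) :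
    #{TU : Tuples n ℓ × Tuples n ℓ | edgeOf p TU.1 TU.2 = some S} =
      #{TU : Tuples n ℓ × Tuples n ℓ | edgeOf p TU.1 TU.2 = some S'} := by
  let e : {x // x ∈ S.1} ≃ {x // x ∈ S'.1} := Fintype.equivOfCardEq (by simp [S.2, S'.2])
  let π : Equiv.Perm (Fin n) := e.extendSubtype
  have hS (s : Fin n) : π s ∈ S'.1 ↔ s ∈ S.1 :=
    ⟨not_imp_not.1 (e.extendSubtype_not_mem s), e.extendSubtype_mem s⟩
  let relabel : Tuples n ℓ ≃ Tuples n ℓ := (Equiv.refl _).embeddingCongr π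
  refine Finset.card_equiv (relabel.prodCongr relabel) fun TU => ?_
  rw [Finset.mem_filter_univ, Finset.mem_filter_univ]
  exact (edgeOf_trans_perm π hS).symm

lemma card_pairs_edgeOf_mul (S : Hyperedge n (2 * q)) :
    #{TU : Tuples n ℓ × Tuples n ℓ | edgeOf (2 * q) TU.1 TU.2 = some S} *
        Fintype.card (Hyperedge n (2 * q)) =
      Fintype.card (Tuples n ℓ) * kikuchiDegree n ℓ q := by
  calc _ = ∑ S' : Hyperedge n (2 * q),
        #{TU : Tuples n ℓ × Tuples n ℓ | edgeOf (2 * q) TU.1 TU.2 = some S'} := by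
        rw [Finset.sum_congr rfl fun S' _ => card_pairs_edgeOf_eq S' S, Finset.sum_const,
          smul_eq_mul, mul_comm, Finset.card_univ]
    _ = ∑ T : Tuples n ℓ, #{U | (edgeOf (2 * q) T U).isSome} := by
        simp_rw [Finset.card_filter]
        rw [Finset.sum_comm, Fintype.sum_prod_type]
        refine Finset.sum_congr rfl fun T _ => Finset.sum_congr rfl fun U _ => ?_
        cases edgeOf (2 * q) T U <;> simp
    _ = Fintype.card (Tuples n ℓ) * kikuchiDegree n ℓ q := by
        rw [Finset.sum_congr rfl fun T _ => card_filter_edgeOf_isSome T, Finset.sum_const,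
          smul_eq_mul, Finset.card_univ]

/-! ### The Kikuchi matrix at a tensor power of a sign vector -/

/-- The `ℓ`-th tensor power of `w`, restricted to the tuples with distinct entries. -/
def tensorPower (ℓ : ℕ) (w : Fin n → ℝ) (T : Tuples n ℓ) : ℝ := ∏ a, w (T a)

lemma tensorPower_mul_tensorPower_of_edgeOf {w : Fin n → ℝ} (hw : ∀ s, w s * w s = 1)
    {S : Hyperedge n p} (hS : edgeOf p T U = some S) :
    tensorPower ℓ w T * tensorPower ℓ w U = ∏ s ∈ S.1, w s := by
  obtain ⟨-, hnodup, hS⟩ := edgeOf_eq_some.1 hS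
  calc tensorPower ℓ w T * tensorPower ℓ w U
      = ∏ a, w (T a) * w (U a) := Finset.prod_mul_distrib.symm
    _ = ∏ a ∈ diffSet T U, w (T a) * w (U a) := by
        refine (Finset.prod_subset (Finset.subset_univ _) fun a _ ha => ?_).symm
        rw [eq_of_notMem_diffSet ha, hw]
    _ = ∏ s ∈ S.1, w s := by
        rw [← hS, List.prod_toFinset _ hnodup, ominus, List.map_append, List.prod_append,
          List.map_map, List.map_map, ← List.prod_toFinset _ (disagreements_nodup T U),
          ← List.prod_toFinset _ (disagreements_nodup T U), toFinset_disagreements,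
          ← Finset.prod_mul_distrib]
        rfl

lemma tensorPower_dotProduct_self {w : Fin n → ℝ} (hw : ∀ s, w s * w s = 1) :
    tensorPower ℓ w ⬝ᵥ tensorPower ℓ w = Fintype.card (Tuples n ℓ) := by
  simp [dotProduct, tensorPower, ← Finset.prod_mul_distrib, hw]

lemma tensorPower_quadraticForm_edgeMatrix {w : Fin n → ℝ} (hw : ∀ s, w s * w s = 1)
    (A : Hyperedge n (2 * q) → ℝ) :
    tensorPower ℓ w ⬝ᵥ edgeMatrix (edgeOf (2 * q)) A *ᵥ tensorPower ℓ w =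
      Fintype.card (Tuples n ℓ) * kikuchiDegree n ℓ q * 𝔼 S, A S * ∏ s ∈ S.1, w s := by
  have hpairs : tensorPower ℓ w ⬝ᵥ edgeMatrix (edgeOf (2 * q)) A *ᵥ tensorPower ℓ w =
      ∑ TU : Tuples n ℓ × Tuples n ℓ, ∑ S,
        if edgeOf (2 * q) TU.1 TU.2 = some S then A S * ∏ s ∈ S.1, w s else 0 := by
    rw [Fintype.sum_prod_type]
    simp only [dotProduct, Matrix.mulVec, Finset.mul_sum]
    refine Finset.sum_congr rfl fun T _ => Finset.sum_congr rfl fun U _ => ?_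
    cases hU : edgeOf (2 * q) T U with
    | none => simp [edgeMatrix, hU]
    | some S =>
      simp only [edgeMatrix, Matrix.of_apply, hU, Option.elim_some, Option.some.injEq,
        Finset.sum_ite_eq, Finset.mem_univ, if_true, ← tensorPower_mul_tensorPower_of_edgeOf hw hU]
      ring
  rw [hpairs, Finset.sum_comm, Fintype.expect_eq_sum_div_card, Finset.sum_div, Finset.mul_sum]
  refine Finset.sum_congr rfl fun S _ => ?_
  have hcard : (Fintype.card (Hyperedge n (2 * q)) : ℝ) ≠ 0 :=
    Nat.cast_ne_zero.2 (Fintype.card_pos_iff.2 ⟨S⟩).ne'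
  have hcount := congrArg (Nat.cast : ℕ → ℝ) (card_pairs_edgeOf_mul (ℓ := ℓ) S)
  push_cast at hcount
  rw [← Finset.sum_filter, Finset.sum_const, nsmul_eq_mul, mul_div_assoc', eq_div_iff hcard,
    ← hcount]
  ring

end Labels

/-! ### The null law -/

instance (r : ℝ) : IsProbabilityMeasure (bern r) := by
  unfold bern
  infer_instance

instance (n p : ℕ) (θ₀ : ℝ) : IsProbabilityMeasure (nullLaw n p θ₀) := by
  unfold nullLaw
  infer_instance

instance (n p : ℕ) {k : ℕ} (θ₀ ε : ℝ) (x : Fin n → Fin k) :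
    IsProbabilityMeasure (condLaw n p θ₀ ε x) := by
  unfold condLaw
  infer_instance

lemma integral_bern {r : ℝ} (hr : r ∈ Set.Icc (0 : ℝ) 1) (g : Bool → ℝ) :
    ∫ b, g b ∂bern r = r * g true + (1 - r) * g false := by
  rw [bern, integral_bernoulliMeasure, Set.projIcc_of_mem _ hr]
  simp

/-- The normalized indicator `A_S` as a function of the single bit `Y_S`. -/
noncomputable def normalizedBit (θ₀ : ℝ) (b : Bool) : ℝ :=
  ((if b then (1 : ℝ) else 0) - θ₀) / √(θ₀ * (1 - θ₀))

section Bits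

variable {θ₀ r : ℝ}

lemma integral_normalizedBit (hr : r ∈ Set.Icc (0 : ℝ) 1) :
    ∫ b, normalizedBit θ₀ b ∂bern r = (r - θ₀) / √(θ₀ * (1 - θ₀)) := by
  rw [integral_bern hr]
  simp only [normalizedBit, if_true, Bool.false_eq_true, if_false]
  ring

lemma integral_normalizedBit_sq (hθ₀ : θ₀ ∈ Set.Ioo (0 : ℝ) 1) (hr : r ∈ Set.Icc (0 : ℝ) 1) :
    ∫ b, normalizedBit θ₀ b ^ 2 ∂bern r =
      (r * (1 - θ₀) ^ 2 + (1 - r) * θ₀ ^ 2) / (θ₀ * (1 - θ₀)) := by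
  have hvar : 0 ≤ θ₀ * (1 - θ₀) := mul_nonneg hθ₀.1.le (sub_nonneg.2 hθ₀.2.le)
  rw [integral_bern hr]
  simp only [normalizedBit, if_true, Bool.false_eq_true, if_false, div_pow, Real.sq_sqrt hvar]
  ring

lemma integral_normalizedBit_sq_self (hθ₀ : θ₀ ∈ Set.Ioo (0 : ℝ) 1) :
    ∫ b, normalizedBit θ₀ b ^ 2 ∂bern θ₀ = 1 := by
  have hvar : θ₀ * (1 - θ₀) ≠ 0 := (mul_pos hθ₀.1 (sub_pos.2 hθ₀.2)).ne'
  rw [integral_normalizedBit_sq hθ₀ (Set.Ioo_subset_Icc_self hθ₀), div_eq_one_iff_eq hvar]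
  ring

lemma abs_normalizedBit_le (hθ₀ : 0 ≤ θ₀) (hθ₀' : θ₀ ≤ 1 / 2) (b : Bool) :
    |normalizedBit θ₀ b| ≤ (1 - θ₀) / √(θ₀ * (1 - θ₀)) := by
  rw [normalizedBit, abs_div, abs_of_nonneg (Real.sqrt_nonneg _)]
  gcongr
  cases b
  · simp only [Bool.false_eq_true, if_false, zero_sub, abs_neg, abs_of_nonneg hθ₀]
    linarith
  · simp only [if_true]
    rw [abs_of_nonneg (by linarith)]

lemma abs_integral_prod_normalized_pow_le {n p : ℕ} (hθ₀ : 0 < θ₀) (hθ₀' : θ₀ ≤ 1 / 2)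
    (j : Hyperedge n p → ℕ) :
    |∫ Y, ∏ S, normalized θ₀ Y S ^ j S ∂nullLaw n p θ₀| ≤
      ∏ S, momentBound ((1 - θ₀) / √(θ₀ * (1 - θ₀))) (j S) := by
  have hθ₀_mem : θ₀ ∈ Set.Ioo (0 : ℝ) 1 := ⟨hθ₀, by linarith⟩
  have hindep : ∫ Y, ∏ S, normalized θ₀ Y S ^ j S ∂nullLaw n p θ₀ =
      ∏ S, ∫ b, normalizedBit θ₀ b ^ j S ∂bern θ₀ :=
    integral_fintype_prod_eq_prod fun (S : Hyperedge n p) b => normalizedBit θ₀ b ^ j S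
  have hmean : ∫ b, normalizedBit θ₀ b ∂bern θ₀ = 0 := by
    rw [integral_normalizedBit (Set.Ioo_subset_Icc_self hθ₀_mem), sub_self, zero_div]
  rw [hindep, Finset.abs_prod]
  exact Finset.prod_le_prod (fun _ _ => abs_nonneg _) fun S _ =>
    abs_integral_pow_le_momentBound hmean (integral_normalizedBit_sq_self hθ₀_mem).le
      (abs_normalizedBit_le hθ₀.le hθ₀') (j S)

end Bits

section NullTail

variable {n ℓ q : ℕ} {θ₀ ε : ℝ}

lemma snr_pos (hε : 0 < ε) (hθ : ε < θ₀) (hθ₀ : θ₀ < 1) : 0 < snr θ₀ ε :=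
  div_pos hε (Real.sqrt_pos.2 (mul_pos (hε.trans hθ) (sub_pos.2 hθ₀)))

lemma kikuchiDegree_mul_factorial_le (n ℓ q : ℕ) :
    kikuchiDegree n ℓ q * q ! ≤ n ^ q * ℓ ^ q :=
  calc kikuchiDegree n ℓ q * q ! = (n - ℓ).descFactorial q * ℓ.descFactorial q := by
        rw [kikuchiDegree, ℓ.descFactorial_eq_factorial_mul_choose]
        ring
    _ ≤ n ^ q * ℓ ^ q :=
        Nat.mul_le_mul ((Nat.descFactorial_le_pow _ _).trans
          (Nat.pow_le_pow_left (Nat.sub_le _ _) _)) (Nat.descFactorial_le_pow _ _)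

lemma card_tuples_le_pow (n ℓ : ℕ) : Fintype.card (Tuples n ℓ) ≤ n ^ ℓ := by
  rw [Fintype.card_embedding_eq, Fintype.card_fin, Fintype.card_fin]
  exact Nat.descFactorial_le_pow _ _

lemma nullLaw_real_kikuchiMax_ge_le_pow_mul_exp (hθ₀ : 0 < θ₀) (hθ₀' : θ₀ ≤ 1 / 2) (hℓ : ℓ ≤ n)
    {t : ℝ} (ht : 0 < t)
    (hbulk : q ! * ((1 - θ₀) / √(θ₀ * (1 - θ₀))) * t ≤ 2 * ((n : ℝ) ^ q * (ℓ : ℝ) ^ q)) :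
    (nullLaw n (2 * q) θ₀).real {Y | t ≤ kikuchiMax ℓ θ₀ Y} ≤
      (n : ℝ) ^ ℓ * Real.exp (-(t ^ 2 / (4 * ((n : ℝ) ^ q * (ℓ : ℝ) ^ q)))) := by
  have : Nonempty (Tuples n ℓ) := ⟨Fin.castLEEmb hℓ⟩
  have hB : 0 < (1 - θ₀) / √(θ₀ * (1 - θ₀)) :=
    div_pos (by linarith) (Real.sqrt_pos.2 (mul_pos hθ₀ (by linarith)))
  have htail := measureReal_lambdaMax_edgeMatrix_ge_le (μ := nullLaw n (2 * q) θ₀)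
    (edge := edgeOf (ℓ := ℓ) (2 * q)) (A := normalized θ₀) (d := kikuchiDegree n ℓ q)
    (h := q !) hB (by exact_mod_cast q.factorial_pos) (edgeOf_comm _)
    (fun T S => by exact_mod_cast card_filter_edgeOf_eq_some_le T S)
    (fun T => by rw [card_filter_edgeOf_isSome])
    (abs_integral_prod_normalized_pow_le hθ₀ hθ₀')
    (by exact_mod_cast kikuchiDegree_mul_factorial_le n ℓ q) ht hbulk
  simp only [kikuchiMax, kikuchi_tensor_eq_edgeMatrix]
  refine htail.trans ?_
  gcongr
  exact_mod_cast card_tuples_le_pow n ℓ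

lemma normalizedBit_bound_mul_snr_le_one (hε : 0 < ε) (hθ : ε < θ₀) (hθ₀ : θ₀ < 1) :
    (1 - θ₀) / √(θ₀ * (1 - θ₀)) * snr θ₀ ε ≤ 1 := by
  have hvar : 0 < θ₀ * (1 - θ₀) := mul_pos (hε.trans hθ) (sub_pos.2 hθ₀)
  rw [snr, div_mul_div_comm, Real.mul_self_sqrt hvar.le, div_le_one hvar, mul_comm]
  exact mul_le_mul_of_nonneg_right hθ.le (sub_nonneg.2 hθ₀.le)

theorem nullLaw_real_kikuchiMax_ge_le {C : ℝ} (hε : 0 < ε) (hθ : ε < θ₀) (hθ₀ : θ₀ ≤ 1 / 2)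
    (hℓ0 : 0 < ℓ) (hℓ : ℓ ≤ n) (hC : 0 < C) (hCq : C * q ! ≤ 1)
    (hsnr : 54 * (ℓ * Real.log n) ≤ (C * snr θ₀ ε) ^ 2 * ((n : ℝ) ^ q * (ℓ : ℝ) ^ q)) :
    (nullLaw n (2 * q) θ₀).real
        {Y | C / 3 * snr θ₀ ε * ((n : ℝ) ^ q * (ℓ : ℝ) ^ q) ≤ kikuchiMax ℓ θ₀ Y} ≤
      Real.exp (-(ℓ * Real.log n / 2)) := by
  have hn : (0 : ℝ) < n := by exact_mod_cast hℓ0.trans_le hℓ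
  set β := snr θ₀ ε
  set B := (1 - θ₀) / √(θ₀ * (1 - θ₀))
  set σ : ℝ := (n : ℝ) ^ q * (ℓ : ℝ) ^ q
  have hβ : 0 < β := snr_pos hε hθ (by linarith)
  have hσ : 0 < σ := by positivity
  have hbulk : q ! * B * (C / 3 * β * σ) ≤ 2 * σ :=
    calc q ! * B * (C / 3 * β * σ) = C * q ! * (B * β) * (σ / 3) := by ring
      _ ≤ 1 * 1 * (σ / 3) := by
          have hB : 0 ≤ B := div_nonneg (by linarith) (Real.sqrt_nonneg _)
          gcongr
          exact normalizedBit_bound_mul_snr_le_one hε hθ (by linarith)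
      _ ≤ 2 * σ := by linarith
  have hexponent : 3 / 2 * (ℓ * Real.log n) ≤ (C / 3 * β * σ) ^ 2 / (4 * σ) :=
    calc 3 / 2 * (ℓ * Real.log n) ≤ (C * β) ^ 2 * σ / 36 := by linarith
      _ = (C / 3 * β * σ) ^ 2 / (4 * σ) := by field_simp; norm_num
  have hcard : (n : ℝ) ^ ℓ = Real.exp (ℓ * Real.log n) := by
    rw [mul_comm, Real.exp_mul, Real.exp_log hn, Real.rpow_natCast]
  calc _ ≤ (n : ℝ) ^ ℓ * Real.exp (-((C / 3 * β * σ) ^ 2 / (4 * σ))) :=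
        nullLaw_real_kikuchiMax_ge_le_pow_mul_exp (hε.trans hθ) hθ₀ hℓ (by positivity) hbulk
    _ = Real.exp (ℓ * Real.log n - (C / 3 * β * σ) ^ 2 / (4 * σ)) := by
        rw [hcard, ← Real.exp_add, sub_eq_add_neg]
    _ ≤ Real.exp (-(ℓ * Real.log n / 2)) := Real.exp_le_exp.2 (by linarith)

end NullTail

/-! ### Uniform labels -/

section UniformAverages

variable {ι α : Type*} [Fintype ι]

lemma expect_prod_apply [DecidableEq ι] {β : ι → Type*} [∀ i, Fintype (β i)] (g : ∀ i, β i → ℝ) :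
    𝔼 x : ∀ i, β i, ∏ i, g i (x i) = ∏ i, 𝔼 b, g i b := by
  simp only [Fintype.expect_eq_sum_div_card, Finset.prod_div_distrib, Finset.prod_univ_sum,
    Fintype.piFinset_univ, Fintype.card_pi, Nat.cast_prod]

lemma expect_prod_mul_prod_of_disjoint [DecidableEq ι] [Fintype α] [Nonempty α] {s t : Finset ι}
    (hst : Disjoint s t) (u v : α → ℝ) :
    𝔼 x : ι → α, (∏ i ∈ s, u (x i)) * ∏ i ∈ t, v (x i) = (𝔼 a, u a) ^ #s * (𝔼 a, v a) ^ #t := by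
  let g (i : ι) (a : α) : ℝ := (if i ∈ s then u a else 1) * if i ∈ t then v a else 1
  have hmean (i : ι) : 𝔼 a, g i a =
      (if i ∈ s then 𝔼 a, u a else 1) * if i ∈ t then 𝔼 a, v a else 1 := by
    by_cases hs : i ∈ s
    · simp [g, hs, Finset.disjoint_left.1 hst hs]
    · by_cases ht : i ∈ t <;> simp [g, hs, ht]
  calc 𝔼 x : ι → α, (∏ i ∈ s, u (x i)) * ∏ i ∈ t, v (x i)
      = 𝔼 x : ι → α, ∏ i, g i (x i) := by
        simp only [g, Finset.prod_mul_distrib, Finset.prod_ite_mem, Finset.univ_inter]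
    _ = ∏ i, 𝔼 a, g i a := expect_prod_apply g
    _ = (𝔼 a, u a) ^ #s * (𝔼 a, v a) ^ #t := by
        simp only [hmean, Finset.prod_mul_distrib, Finset.prod_ite_mem, Finset.univ_inter,
          Finset.prod_const]

lemma abs_prod_le_half_add_sq {u : ι → ℝ} (hu : ∀ i, |u i| ≤ 1) {i j : ι} (hij : i ≠ j) :
    |∏ m, u m| ≤ (u i ^ 2 + u j ^ 2) / 2 := by
  classical
  have hrest : ∏ m ∈ {i, j}ᶜ, |u m| ≤ 1 :=
    Finset.prod_le_one (fun _ _ => abs_nonneg _) fun m _ => hu m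
  calc |∏ m, u m| = (|u i| * |u j|) * ∏ m ∈ {i, j}ᶜ, |u m| := by
        rw [Finset.abs_prod, ← Finset.prod_mul_prod_compl {i, j}, Finset.prod_pair hij]
    _ ≤ |u i| * |u j| := mul_le_of_le_one_right (by positivity) hrest
    _ ≤ (u i ^ 2 + u j ^ 2) / 2 := by
        rw [← sq_abs (u i), ← sq_abs (u j)]
        linarith [two_mul_le_add_sq |u i| |u j|]

end UniformAverages

section Signal

variable {n k p : ℕ}

/-- The centered indicator `1_{a = i} - 1/k`, a factor of the function `f`. -/
noncomputable def centered (i a : Fin k) : ℝ := (if a = i then (1 : ℝ) else 0) - 1 / (k : ℝ)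

lemma f_restrictLabels (x : Fin n → Fin k) (S : Hyperedge n p) :
    f (restrictLabels x S) = ∑ i, ∏ s ∈ S.1, centered i (x s) := by
  refine Finset.sum_congr rfl fun i _ => ?_
  conv_rhs => rw [← Finset.map_orderEmbOfFin_univ S.1 S.2, Finset.prod_map]
  rfl

lemma abs_centered_le_one (i a : Fin k) : |centered i a| ≤ 1 := by
  have hk : (1 : ℝ) ≤ k := by exact_mod_cast Fin.pos a
  have hinv_le : 1 / (k : ℝ) ≤ 1 := (div_le_one (by linarith)).2 hk
  have hinv_nonneg : 0 ≤ 1 / (k : ℝ) := by positivity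
  rw [centered, abs_le]
  split_ifs <;> constructor <;> linarith

lemma sum_centered_sq (a : Fin k) : ∑ i, centered i a ^ 2 = 1 - 1 / k := by
  have hk : (k : ℝ) ≠ 0 := Nat.cast_ne_zero.2 (Fin.pos a).ne'
  have hterm (i : Fin k) : centered i a ^ 2 =
      (if a = i then (1 - 2 / k : ℝ) else 0) + 1 / (k : ℝ) ^ 2 := by
    unfold centered
    split_ifs <;> ring
  simp only [hterm, Finset.sum_add_distrib, Finset.sum_ite_eq, Finset.mem_univ, if_true,
    Finset.sum_const, Finset.card_univ, Fintype.card_fin, nsmul_eq_mul]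
  field_simp
  ring

lemma abs_f_le_one (hp : 2 ≤ p) (a : Fin p → Fin k) : |f a| ≤ 1 := by
  let j₀ : Fin p := ⟨0, by omega⟩
  let j₁ : Fin p := ⟨1, by omega⟩
  have hne : j₀ ≠ j₁ := by simp [j₀, j₁]
  have hk : 0 ≤ 1 / (k : ℝ) := by positivity
  calc |f a| ≤ ∑ i, |∏ j, centered i (a j)| := Finset.abs_sum_le_sum_abs _ _
    _ ≤ ∑ i, (centered i (a j₀) ^ 2 + centered i (a j₁) ^ 2) / 2 :=
        Finset.sum_le_sum fun i _ => abs_prod_le_half_add_sq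
          (fun j => abs_centered_le_one i (a j)) hne
    _ = 1 - 1 / k := by
        rw [← Finset.sum_div, Finset.sum_add_distrib, sum_centered_sq, sum_centered_sq]
        ring
    _ ≤ 1 := by linarith

variable [NeZero k]

/-- The sign separating the label `0` from all other labels; the planted law is detected through
the sign vector `s ↦ labelSign (x s)`. -/
def labelSign (a : Fin k) : ℝ := if a = 0 then 1 else -1

lemma labelSign_mul_self (a : Fin k) : labelSign a * labelSign a = 1 := by
  unfold labelSign
  split_ifs <;> norm_num

lemma sq_prod_labelSign (x : Fin n → Fin k) (S : Finset (Fin n)) :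
    (∏ s ∈ S, labelSign (x s)) ^ 2 = 1 := by
  simp only [sq, ← Finset.prod_mul_distrib, labelSign_mul_self, Finset.prod_const_one]

variable (k p) in
/-- The mean, over uniform labels, of `f` times the product of the label signs on a hyperedge of
size `p`, see `expect_edgeSignal`. -/
noncomputable def signalStrength : ℝ := ∑ i : Fin k, (𝔼 a, labelSign a * centered i a) ^ p

lemma signalStrength_pos (hk : 2 ≤ k) (hp : Even p) : 0 < signalStrength k p := by
  have hk' : (2 : ℝ) ≤ k := by exact_mod_cast hk
  have hinv_pos : 0 < 1 / (k : ℝ) := by positivity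
  have hinv_lt : 1 / (k : ℝ) < 1 := (div_lt_one (by linarith)).2 (by linarith)
  have hzero : 0 < 𝔼 a : Fin k, labelSign a * centered 0 a := by
    refine Finset.expect_pos (fun a _ => ?_) Finset.univ_nonempty
    unfold labelSign centered
    split_ifs <;> linarith
  exact Finset.sum_pos' (fun i _ => hp.pow_nonneg _) ⟨0, Finset.mem_univ _, pow_pos hzero p⟩

/-- The contribution of the hyperedge `S` to the correlation of the hypergraph with the sign
vector of `x`, on the scale of `ε`. -/
noncomputable def edgeSignal (x : Fin n → Fin k) (S : Hyperedge n p) : ℝ :=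
  f (restrictLabels x S) * ∏ s ∈ S.1, labelSign (x s)

lemma edgeSignal_eq (x : Fin n → Fin k) (S : Hyperedge n p) :
    edgeSignal x S = ∑ i, ∏ s ∈ S.1, labelSign (x s) * centered i (x s) := by
  rw [edgeSignal, f_restrictLabels, mul_comm, Finset.mul_sum]
  simp only [Finset.prod_mul_distrib]

lemma abs_edgeSignal_le (hp : 2 ≤ p) (x : Fin n → Fin k) (S : Hyperedge n p) :
    |edgeSignal x S| ≤ 1 := by
  have hsign : |∏ s ∈ S.1, labelSign (x s)| = 1 :=
    (pow_eq_one_iff_of_nonneg (abs_nonneg _) two_ne_zero).1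
      ((sq_abs _).trans (sq_prod_labelSign x S.1))
  rw [edgeSignal, abs_mul, hsign, mul_one]
  exact abs_f_le_one hp _

lemma expect_edgeSignal (S : Hyperedge n p) :
    𝔼 x : Fin n → Fin k, edgeSignal x S = signalStrength k p := by
  simp only [edgeSignal_eq, Finset.expect_sum_comm, signalStrength]
  refine Finset.sum_congr rfl fun i _ => ?_
  simpa [S.2] using expect_prod_mul_prod_of_disjoint (Finset.disjoint_empty_right S.1)
    (fun a => labelSign a * centered i a) (fun _ => 1)

lemma expect_edgeSignal_mul_of_disjoint {S S' : Hyperedge n p} (hd : Disjoint S.1 S'.1) :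
    𝔼 x : Fin n → Fin k, edgeSignal x S * edgeSignal x S' = signalStrength k p ^ 2 := by
  simp only [edgeSignal_eq, Finset.sum_mul_sum, Finset.expect_sum_comm, signalStrength, sq]
  refine Finset.sum_congr rfl fun i _ => Finset.sum_congr rfl fun j _ => ?_
  simpa only [S.2, S'.2] using expect_prod_mul_prod_of_disjoint hd
    (fun a => labelSign a * centered i a) (fun a => labelSign a * centered j a)

lemma abs_signalStrength_le_one (hp : 2 ≤ p) : |signalStrength k p| ≤ 1 := by
  rw [← expect_edgeSignal (⟨Finset.univ, by simp⟩ : Hyperedge p p)]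
  exact (Finset.abs_expect_le _ _).trans
    (Finset.expect_le Finset.univ_nonempty fun x _ => abs_edgeSignal_le hp x _)

lemma expect_edgeSignal_covariance_le (hp : 2 ≤ p) (S S' : Hyperedge n p) :
    𝔼 x : Fin n → Fin k,
        (edgeSignal x S - signalStrength k p) * (edgeSignal x S' - signalStrength k p) ≤
      if ¬ Disjoint S.1 S'.1 then 4 else 0 := by
  by_cases hd : Disjoint S.1 S'.1
  · simp only [mul_sub, sub_mul, Finset.expect_sub_distrib, ← Finset.expect_mul,
      ← Finset.mul_expect, expect_edgeSignal_mul_of_disjoint hd, expect_edgeSignal,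
      Fintype.expect_const, hd, not_true_eq_false, if_false]
    exact le_of_eq (by ring)
  · rw [if_pos hd]
    have hdev (x : Fin n → Fin k) (S : Hyperedge n p) :
        |edgeSignal x S - signalStrength k p| ≤ 2 :=
      (abs_sub _ _).trans (by linarith [abs_edgeSignal_le hp x S,
        abs_signalStrength_le_one (k := k) hp])
    refine Finset.expect_le Finset.univ_nonempty fun x _ => (le_abs_self _).trans ?_
    rw [abs_mul]
    linarith [mul_le_mul (hdev x S) (hdev x S') (abs_nonneg _) zero_le_two]

end Signal

section Concentration

variable {n p : ℕ}

lemma card_hyperedge (n p : ℕ) : Fintype.card (Hyperedge n p) = n.choose p := by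
  rw [Fintype.card_finset_len, Fintype.card_fin]

lemma card_filter_mem_hyperedge_le (s : Fin n) :
    #{S : Hyperedge n p | s ∈ S.1} ≤ (n - 1).choose (p - 1) := by
  have hcard : #(Finset.powersetCard (p - 1) (Finset.univ.erase s)) = (n - 1).choose (p - 1) := by
    rw [Finset.card_powersetCard, Finset.card_erase_of_mem (Finset.mem_univ s), Finset.card_univ,
      Fintype.card_fin]
  rw [← hcard]
  refine Finset.card_le_card_of_injOn (fun S => S.1.erase s) (fun S hS => ?_)
    fun S hS S' hS' hSS' => Subtype.ext ?_
  · have hs : s ∈ S.1 := (Finset.mem_filter.1 hS).2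
    exact Finset.mem_coe.2 (Finset.mem_powersetCard.2
      ⟨Finset.erase_subset_erase _ (Finset.subset_univ _), by
        rw [Finset.card_erase_of_mem hs, S.2]⟩)
  · rw [← Finset.insert_erase (Finset.mem_filter.1 hS).2,
      ← Finset.insert_erase (Finset.mem_filter.1 hS').2]
    exact congrArg _ hSS'

lemma card_filter_not_disjoint_le (S : Hyperedge n p) :
    #{S' : Hyperedge n p | ¬ Disjoint S.1 S'.1} ≤ p * (n - 1).choose (p - 1) := by
  have hcover : ({S' | ¬ Disjoint S.1 S'.1} : Finset (Hyperedge n p)) ⊆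
      S.1.biUnion fun s => {S' : Hyperedge n p | s ∈ S'.1} := fun S' hS' => by
    obtain ⟨s, hs, hs'⟩ := Finset.not_disjoint_iff.1 (Finset.mem_filter.1 hS').2
    exact Finset.mem_biUnion.2 ⟨s, hs, Finset.mem_filter.2 ⟨Finset.mem_univ _, hs'⟩⟩
  calc _ ≤ #(S.1.biUnion fun s => {S' : Hyperedge n p | s ∈ S'.1}) := Finset.card_le_card hcover
    _ ≤ #S.1 * (n - 1).choose (p - 1) :=
        Finset.card_biUnion_le_card_mul _ _ _ fun s _ => card_filter_mem_hyperedge_le s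
    _ = _ := by rw [S.2]

lemma expect_not_disjoint_le (hp : 1 ≤ p) (S : Hyperedge n p) :
    𝔼 S' : Hyperedge n p, (if ¬ Disjoint S.1 S'.1 then (4 : ℝ) else 0) ≤ 4 * (p : ℝ) ^ 2 / n := by
  have hpn : p ≤ n := by simpa [S.2] using S.1.card_le_univ
  have hn : (0 : ℝ) < n := by exact_mod_cast hp.trans hpn
  have hchoose : (0 : ℝ) < n.choose p := by exact_mod_cast Nat.choose_pos hpn
  have habsorb : (n : ℝ) * (n - 1).choose (p - 1) = n.choose p * p := by
    obtain ⟨m, rfl⟩ := Nat.exists_eq_succ_of_ne_zero (by omega : n ≠ 0)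
    obtain ⟨r, rfl⟩ := Nat.exists_eq_succ_of_ne_zero (by omega : p ≠ 0)
    exact_mod_cast Nat.add_one_mul_choose_eq m r
  have hcount : (#{S' : Hyperedge n p | ¬ Disjoint S.1 S'.1} : ℝ) ≤
      p * (n - 1).choose (p - 1) := by
    exact_mod_cast card_filter_not_disjoint_le S
  rw [Fintype.expect_eq_sum_div_card, card_hyperedge, ← Finset.sum_filter, Finset.sum_const,
    nsmul_eq_mul, div_le_div_iff₀ hchoose hn]
  calc _ ≤ p * ((n - 1).choose (p - 1) : ℝ) * 4 * n := by gcongr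
    _ = 4 * p * (n * (n - 1).choose (p - 1)) := by ring
    _ = _ := by
        rw [habsorb]
        ring

lemma expect_sq_expect_edgeSignal_sub_le {k : ℕ} [NeZero k] (hp : 2 ≤ p) (hn : p ≤ n) :
    𝔼 x : Fin n → Fin k, (𝔼 S : Hyperedge n p, edgeSignal x S - signalStrength k p) ^ 2 ≤
      4 * (p : ℝ) ^ 2 / n := by
  have hcard : 0 < Fintype.card (Hyperedge n p) := by
    rw [card_hyperedge]
    exact Nat.choose_pos hn
  have : Nonempty (Hyperedge n p) := Fintype.card_pos_iff.1 hcard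
  have hsq (x : Fin n → Fin k) : (𝔼 S : Hyperedge n p, edgeSignal x S - signalStrength k p) ^ 2 =
      𝔼 S : Hyperedge n p, 𝔼 S' : Hyperedge n p,
        (edgeSignal x S - signalStrength k p) * (edgeSignal x S' - signalStrength k p) := by
    rw [← Finset.expect_mul_expect, ← sq, Finset.expect_sub_distrib, Fintype.expect_const]
  simp only [hsq]
  rw [Finset.expect_comm]
  refine Finset.expect_le Finset.univ_nonempty fun S _ => ?_
  rw [Finset.expect_comm]
  exact (Finset.expect_le_expect fun S' _ => expect_edgeSignal_covariance_le hp S S').trans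
    (expect_not_disjoint_le (by omega) S)

end Concentration

/-! ### The planted law -/

section Planted

variable {n k p : ℕ} {θ₀ ε : ℝ}

lemma add_mul_f_mem_Icc (hp : 2 ≤ p) (hε : 0 ≤ ε) (hθ : ε ≤ θ₀) (a : Fin p → Fin k) :
    θ₀ + ε * f a ∈ Set.Icc 0 (2 * θ₀) := by
  have hf : |ε * f a| ≤ ε := by
    rw [abs_mul, abs_of_nonneg hε]
    exact mul_le_of_le_one_right hε (abs_f_le_one hp a)
  obtain ⟨hlo, hhi⟩ := abs_le.1 hf
  constructor <;> linarith

lemma integral_normalizedBit_sq_le_three {r : ℝ} (hθ₀ : 0 < θ₀) (hθ₀' : θ₀ ≤ 1 / 2)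
    (hr : r ∈ Set.Icc 0 (2 * θ₀)) : ∫ b, normalizedBit θ₀ b ^ 2 ∂bern r ≤ 3 := by
  obtain ⟨hr0, hr2⟩ := hr
  have hco : 0 < 1 - θ₀ := by linarith
  rw [integral_normalizedBit_sq ⟨hθ₀, by linarith⟩ ⟨hr0, by linarith⟩,
    div_le_iff₀ (mul_pos hθ₀ hco)]
  have hone : r * (1 - θ₀) ^ 2 ≤ 2 * θ₀ * (1 - θ₀) :=
    mul_le_mul hr2 (pow_le_of_le_one hco.le (by linarith) two_ne_zero) (by positivity)
      (by positivity)
  have hzero : (1 - r) * θ₀ ^ 2 ≤ 1 * (θ₀ * (1 - θ₀)) := by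
    rw [sq]
    exact mul_le_mul (by linarith) (mul_le_mul_of_nonneg_left (by linarith) hθ₀.le)
      (by positivity) zero_le_one
  linarith

lemma integral_condLaw_eval (x : Fin n → Fin k) (S : Hyperedge n p) (g : Bool → ℝ) :
    ∫ Y, g (Y S) ∂condLaw n p θ₀ ε x = ∫ b, g b ∂bern (θ₀ + ε * f (restrictLabels x S)) :=
  integral_comp_eval (X := fun _ : Hyperedge n p => Bool) (i := S) (f := g)
    Integrable.of_finite.aestronglyMeasurable

variable [NeZero k]

/-- The average correlation of the normalized indicators with the sign vector of `x`; up to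
normalization, the quadratic form of the Kikuchi matrix at a tensor power of the sign vector. -/
noncomputable def correlation (θ₀ : ℝ) (x : Fin n → Fin k) (Y : Hypergraph n p) : ℝ :=
  𝔼 S, normalized θ₀ Y S * ∏ s ∈ S.1, labelSign (x s)

lemma integral_correlation (hp : 2 ≤ p) (hε : 0 ≤ ε) (hθ : ε ≤ θ₀) (hθ₀ : θ₀ ≤ 1 / 2)
    (x : Fin n → Fin k) :
    ∫ Y, correlation θ₀ x Y ∂condLaw n p θ₀ ε x =
      snr θ₀ ε * 𝔼 S : Hyperedge n p, edgeSignal x S := by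
  have hmean (S : Hyperedge n p) : ∫ Y, normalized θ₀ Y S ∂condLaw n p θ₀ ε x =
      snr θ₀ ε * f (restrictLabels x S) := by
    obtain ⟨hr0, hr2⟩ := add_mul_f_mem_Icc hp hε hθ (restrictLabels x S)
    calc _ = ∫ b, normalizedBit θ₀ b ∂bern (θ₀ + ε * f (restrictLabels x S)) :=
          integral_condLaw_eval x S (normalizedBit θ₀)
      _ = _ := by
          rw [integral_normalizedBit ⟨hr0, by linarith⟩, snr]
          ring
  simp only [correlation, Fintype.expect_eq_sum_div_card]
  rw [integral_div, integral_finsetSum _ fun S _ => Integrable.of_finite, mul_div_assoc',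
    Finset.mul_sum]
  simp only [integral_mul_const, hmean, edgeSignal, mul_assoc]

lemma variance_correlation_le (hp : 2 ≤ p) (hn : p ≤ n) (hε : 0 < ε) (hθ : ε ≤ θ₀)
    (hθ₀ : θ₀ ≤ 1 / 2) (x : Fin n → Fin k) :
    Var[correlation θ₀ x; condLaw n p θ₀ ε x] ≤ 3 / n.choose p := by
  have hN : (0 : ℝ) < n.choose p := by exact_mod_cast Nat.choose_pos hn
  let X (S : Hyperedge n p) (b : Bool) : ℝ :=
    normalizedBit θ₀ b * ((∏ s ∈ S.1, labelSign (x s)) / n.choose p)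
  have hcorr : correlation θ₀ x = ∑ S, fun Y : Hypergraph n p => X S (Y S) := by
    ext Y
    simp only [correlation, Fintype.expect_eq_sum_div_card, card_hyperedge, Finset.sum_div,
      Finset.sum_apply, X, mul_div_assoc]
    rfl
  have hvar (S : Hyperedge n p) :
      Var[X S; bern (θ₀ + ε * f (restrictLabels x S))] ≤ 3 / (n.choose p : ℝ) ^ 2 := by
    rw [variance_mul_const, div_pow, sq_prod_labelSign, mul_one_div]
    gcongr
    exact (variance_le_expectation_sq Integrable.of_finite.aestronglyMeasurable).trans
      (integral_normalizedBit_sq_le_three (hε.trans_le hθ) hθ₀ (add_mul_f_mem_Icc hp hε.le hθ _))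
  rw [hcorr, condLaw, variance_sum_pi fun S => MemLp.of_discrete]
  refine (Finset.sum_le_sum fun S _ => hvar S).trans_eq ?_
  rw [Finset.sum_const, Finset.card_univ, card_hyperedge, nsmul_eq_mul]
  field_simp

lemma integral_sq_sub_const {Ω : Type*} [MeasurableSpace Ω] {μ : Measure Ω}
    [IsProbabilityMeasure μ] {X : Ω → ℝ} (hX : MemLp X 2 μ) (c : ℝ) :
    ∫ ω, (X ω - c) ^ 2 ∂μ = Var[X; μ] + (∫ ω, X ω ∂μ - c) ^ 2 := by
  have hvar := variance_eq_sub (hX.sub (memLp_const c))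
  have hmean : ∫ ω, (X ω - c) ∂μ = ∫ ω, X ω ∂μ - c := by
    rw [integral_sub (hX.integrable one_le_two) (integrable_const c), integral_const, probReal_univ,
      one_smul]
  simp only [Pi.sub_def, Pi.pow_def, variance_sub_const hX.aestronglyMeasurable, hmean] at hvar
  linarith

lemma plantedLaw_real_apply (s : Set (Hypergraph n p)) :
    (plantedLaw n k p θ₀ ε).real s = 𝔼 x : Fin n → Fin k, (condLaw n p θ₀ ε x).real s := by
  have hk : ((k : ENNReal) ^ n)⁻¹ ≠ ⊤ :=
    ENNReal.inv_ne_top.2 (pow_ne_zero _ (Nat.cast_ne_zero.2 (NeZero.ne k)))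
  have hterm (x : Fin n → Fin k) : (((k : ENNReal) ^ n)⁻¹ • condLaw n p θ₀ ε x) s ≠ ⊤ :=
    ENNReal.mul_ne_top hk (measure_ne_top _ _)
  rw [Fintype.expect_eq_sum_div_card, Measure.real, plantedLaw, Measure.finsetSum_apply,
    ENNReal.toReal_sum fun x _ => hterm x, Finset.sum_div]
  refine Finset.sum_congr rfl fun x _ => ?_
  simp [Measure.real, div_eq_inv_mul]

instance : IsProbabilityMeasure (plantedLaw n k p θ₀ ε) := by
  rw [isProbabilityMeasure_iff_real, plantedLaw_real_apply]
  simp only [probReal_univ, Fintype.expect_one]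

variable {ℓ q : ℕ}

lemma kikuchiDegree_mul_correlation_le_kikuchiMax (hℓ : ℓ ≤ n) (x : Fin n → Fin k)
    (Y : Hypergraph n (2 * q)) :
    kikuchiDegree n ℓ q * correlation θ₀ x Y ≤ kikuchiMax ℓ θ₀ Y := by
  have : Nonempty (Tuples n ℓ) := ⟨Fin.castLEEmb hℓ⟩
  have hcard : (0 : ℝ) < Fintype.card (Tuples n ℓ) := by exact_mod_cast Fintype.card_pos
  have hsign (s : Fin n) : labelSign (x s) * labelSign (x s) = 1 := labelSign_mul_self _
  have hrayleigh := dotProduct_mulVec_le_lambdaMax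
    (edgeMatrix_isHermitian (edgeOf_comm (2 * q)) (normalized θ₀ Y))
    (tensorPower ℓ fun s => labelSign (x s))
  rw [tensorPower_quadraticForm_edgeMatrix hsign, tensorPower_dotProduct_self hsign, mul_comm _
    (Fintype.card _ : ℝ), mul_assoc] at hrayleigh
  rw [kikuchiMax, kikuchi_tensor_eq_edgeMatrix, correlation]
  exact le_of_mul_le_mul_left hrayleigh hcard

lemma condLaw_real_kikuchiMax_le (hq : 1 ≤ q) (hn : 2 * q ≤ n) (hℓ : ℓ ≤ n) (hε : 0 < ε)
    (hθ : ε < θ₀) (hθ₀ : θ₀ ≤ 1 / 2) (hd : 0 < kikuchiDegree n ℓ q) {M : ℝ} (hM : 0 < M)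
    (x : Fin n → Fin k) :
    (condLaw n (2 * q) θ₀ ε x).real
        {Y | kikuchiMax ℓ θ₀ Y ≤ kikuchiDegree n ℓ q * (snr θ₀ ε * M / 2)} ≤
      4 / M ^ 2 * (3 / (n.choose (2 * q) * snr θ₀ ε ^ 2) +
        (𝔼 S : Hyperedge n (2 * q), edgeSignal x S - M) ^ 2) := by
  set β := snr θ₀ ε
  have hβ : 0 < β := snr_pos hε hθ (by linarith)
  have hN : (0 : ℝ) < n.choose (2 * q) := by exact_mod_cast Nat.choose_pos hn
  have hsubset : {Y | kikuchiMax ℓ θ₀ Y ≤ kikuchiDegree n ℓ q * (β * M / 2)} ⊆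
      {Y : Hypergraph n (2 * q) | (β * M / 2) ^ 2 ≤ (correlation θ₀ x Y - β * M) ^ 2} := by
    intro Y hY
    have hcorr : correlation θ₀ x Y ≤ β * M / 2 :=
      le_of_mul_le_mul_left ((kikuchiDegree_mul_correlation_le_kikuchiMax hℓ x Y).trans hY)
        (Nat.cast_pos.2 hd)
    rw [Set.mem_ofPred_eq, ← neg_sq (correlation θ₀ x Y - β * M)]
    exact pow_le_pow_left₀ (by positivity) (by linarith) 2
  have hsecond : ∫ Y, (correlation θ₀ x Y - β * M) ^ 2 ∂condLaw n (2 * q) θ₀ ε x ≤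
      3 / n.choose (2 * q) + (β * 𝔼 S : Hyperedge n (2 * q), edgeSignal x S - β * M) ^ 2 := by
    rw [integral_sq_sub_const MemLp.of_discrete, integral_correlation (by omega) hε.le hθ.le hθ₀]
    gcongr
    exact variance_correlation_le (by omega) hn hε hθ.le hθ₀ x
  have hmarkov := mul_meas_ge_le_integral_of_nonneg (μ := condLaw n (2 * q) θ₀ ε x)
    (f := fun Y => (correlation θ₀ x Y - β * M) ^ 2) (ae_of_all _ fun _ => sq_nonneg _)
    Integrable.of_finite ((β * M / 2) ^ 2)
  calc _ ≤ (condLaw n (2 * q) θ₀ ε x).real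
        {Y | (β * M / 2) ^ 2 ≤ (correlation θ₀ x Y - β * M) ^ 2} := measureReal_mono hsubset
    _ ≤ (3 / n.choose (2 * q) +
          (β * 𝔼 S : Hyperedge n (2 * q), edgeSignal x S - β * M) ^ 2) / (β * M / 2) ^ 2 := by
        rw [le_div_iff₀ (by positivity), mul_comm]
        exact hmarkov.trans hsecond
    _ = _ := by
        rw [← mul_sub]
        field_simp
        norm_num

theorem plantedLaw_real_kikuchiMax_le (hk : 2 ≤ k) (hq : 1 ≤ q) (hn : 2 * q ≤ n) (hℓ : ℓ ≤ n)
    (hε : 0 < ε) (hθ : ε < θ₀) (hθ₀ : θ₀ ≤ 1 / 2) (hd : 0 < kikuchiDegree n ℓ q) :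
    (plantedLaw n k (2 * q) θ₀ ε).real {Y | kikuchiMax ℓ θ₀ Y ≤
        kikuchiDegree n ℓ q * (snr θ₀ ε * signalStrength k (2 * q) / 2)} ≤
      4 / signalStrength k (2 * q) ^ 2 *
        (3 / (n.choose (2 * q) * snr θ₀ ε ^ 2) + 4 * ((2 * q : ℕ) : ℝ) ^ 2 / n) := by
  have hM : 0 < signalStrength k (2 * q) := signalStrength_pos hk (even_two_mul q)
  rw [plantedLaw_real_apply]
  refine (Finset.expect_le_expect fun x _ =>
    condLaw_real_kikuchiMax_le hq hn hℓ hε hθ hθ₀ hd hM x).trans ?_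
  rw [← Finset.mul_expect, Finset.expect_add_distrib, Fintype.expect_const]
  gcongr
  exact expect_sq_expect_edgeSignal_sub_le (by omega) hn

end Planted

/-! ### Detection at the threshold -/

section Counting

lemma pow_le_pow_mul_descFactorial {c m r N : ℕ} (h : N ≤ c * (m + 1 - r)) :
    N ^ r ≤ c ^ r * m.descFactorial r :=
  calc N ^ r ≤ (c * (m + 1 - r)) ^ r := Nat.pow_le_pow_left h r
    _ = c ^ r * (m + 1 - r) ^ r := mul_pow _ _ _
    _ ≤ c ^ r * m.descFactorial r := Nat.mul_le_mul_left _ (Nat.pow_sub_le_descFactorial m r)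

lemma pow_le_mul_choose {n r : ℕ} (h : 2 * r ≤ n) : n ^ r ≤ 2 ^ r * r ! * n.choose r := by
  have hpow := pow_le_pow_mul_descFactorial (c := 2) (m := n) (r := r) (N := n) (by omega)
  rwa [Nat.descFactorial_eq_factorial_mul_choose, ← mul_assoc] at hpow

lemma pow_mul_pow_le_mul_kikuchiDegree {n ℓ q : ℕ} (hq : 1 ≤ q) (hℓ : q ≤ ℓ) (hn : 4 * ℓ ≤ n) :
    n ^ q * ℓ ^ q ≤ (2 * q) ^ q * q ! * kikuchiDegree n ℓ q := by
  have hn_pow : n ^ q ≤ 2 ^ q * (n - ℓ).descFactorial q :=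
    pow_le_pow_mul_descFactorial (by omega)
  have hℓ_pow : ℓ ^ q ≤ q ^ q * ℓ.descFactorial q := by
    refine pow_le_pow_mul_descFactorial ?_
    obtain ⟨d, rfl⟩ := Nat.exists_eq_add_of_le hℓ
    rw [show q + d + 1 - q = d + 1 by omega]
    nlinarith
  calc n ^ q * ℓ ^ q ≤ (2 ^ q * (n - ℓ).descFactorial q) * (q ^ q * ℓ.descFactorial q) :=
        Nat.mul_le_mul hn_pow hℓ_pow
    _ = (2 * q) ^ q * q ! * kikuchiDegree n ℓ q := by
        rw [kikuchiDegree, ℓ.descFactorial_eq_factorial_mul_choose, mul_pow]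
        ring

end Counting

section Threshold

variable {n ℓ q : ℕ} {C β : ℝ}

lemma threshold_two_mul (C : ℝ) (n q ℓ : ℕ) (β : ℝ) :
    threshold C n (2 * q) ℓ β = 1 / 2 * C * β * ((n : ℝ) ^ q * (ℓ : ℝ) ^ q) := by
  have hq : ((2 * q : ℕ) : ℝ) / 2 = q := by
    push_cast
    ring
  rw [threshold, hq, Real.rpow_natCast, Real.rpow_natCast]
  ring

lemma sq_rpow_mul_pow {x : ℝ} (hx : 0 < x) (a : ℝ) (q : ℕ) :
    (x ^ (a - ((2 * q : ℕ) : ℝ) / 4)) ^ 2 * x ^ q = x ^ (2 * a) := by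
  rw [← Real.rpow_natCast, ← Real.rpow_natCast, ← Real.rpow_mul hx.le, ← Real.rpow_add hx]
  congr 1
  push_cast
  ring

lemma mul_log_le_of_snr_ge (hn : 0 < n) (hℓ : 0 < ℓ) (hC : 0 < C)
    (hβ : 3 * √6 / C * (ℓ : ℝ) ^ ((1 : ℝ) / 2 - ((2 * q : ℕ) : ℝ) / 4) *
      (n : ℝ) ^ (-((2 * q : ℕ) : ℝ) / 4) * √(Real.log n) ≤ β) :
    54 * (ℓ * Real.log n) ≤ (C * β) ^ 2 * ((n : ℝ) ^ q * (ℓ : ℝ) ^ q) := by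
  have hn' : (0 : ℝ) < n := by exact_mod_cast hn
  have hℓ' : (0 : ℝ) < ℓ := by exact_mod_cast hℓ
  have hlog : 0 ≤ Real.log n := Real.log_natCast_nonneg n
  set a := (ℓ : ℝ) ^ ((1 : ℝ) / 2 - ((2 * q : ℕ) : ℝ) / 4)
  set b := (n : ℝ) ^ (-((2 * q : ℕ) : ℝ) / 4) with hb
  have ha_sq : a ^ 2 * (ℓ : ℝ) ^ q = ℓ := by
    have hsq := sq_rpow_mul_pow hℓ' (1 / 2) q
    rwa [mul_one_div_cancel two_ne_zero, Real.rpow_one] at hsq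
  have hb_sq : b ^ 2 * (n : ℝ) ^ q = 1 := by
    simpa [hb, neg_div] using sq_rpow_mul_pow hn' 0 q
  have hscaled : 3 * √6 * a * b * √(Real.log n) ≤ C * β := by
    refine le_of_eq_of_le ?_ (mul_le_mul_of_nonneg_left hβ hC.le)
    field_simp
  calc 54 * (ℓ * Real.log n)
      = (3 * √6 * a * b * √(Real.log n)) ^ 2 * ((n : ℝ) ^ q * (ℓ : ℝ) ^ q) := by
        simp only [mul_pow, Real.sq_sqrt hlog, Real.sq_sqrt (show (0 : ℝ) ≤ 6 by norm_num)]
        linear_combination (-(54 * Real.log n)) * ha_sq -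
          54 * Real.log n * (a ^ 2 * (ℓ : ℝ) ^ q) * hb_sq
    _ ≤ (C * β) ^ 2 * ((n : ℝ) ^ q * (ℓ : ℝ) ^ q) := by gcongr

lemma le_sq_mul_pow_of_mul_log_le (hq : 1 ≤ q) (hn : 3 ≤ n) (hℓ : 0 < ℓ) (hℓn : ℓ ≤ n)
    (hC : 0 ≤ C) (hC' : C ≤ 1)
    (hβ : 54 * (ℓ * Real.log n) ≤ (C * β) ^ 2 * ((n : ℝ) ^ q * (ℓ : ℝ) ^ q)) :
    (n : ℝ) ≤ β ^ 2 * (n : ℝ) ^ (2 * q) := by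
  have hℓ' : (0 : ℝ) < ℓ := by exact_mod_cast hℓ
  have hn' : (3 : ℝ) ≤ n := by exact_mod_cast hn
  have hlog : 1 ≤ Real.log n :=
    (Real.le_log_iff_exp_le (by linarith)).2 (by linarith [Real.exp_one_lt_d9])
  obtain ⟨r, rfl⟩ := Nat.exists_eq_add_of_le' hq
  have hcancel : 54 * Real.log n ≤ (C * β) ^ 2 * ((n : ℝ) ^ (r + 1) * (ℓ : ℝ) ^ r) := by
    refine le_of_mul_le_mul_left ?_ hℓ'
    calc _ = 54 * (ℓ * Real.log n) := by ring
      _ ≤ _ := hβ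
      _ = _ := by ring
  have hCβ : (C * β) ^ 2 ≤ β ^ 2 := by
    rw [mul_pow]
    exact mul_le_of_le_one_left (sq_nonneg _) (pow_le_one₀ hC hC')
  calc (n : ℝ) ≤ 54 * Real.log n * n := le_mul_of_one_le_left (by positivity) (by linarith)
    _ ≤ (C * β) ^ 2 * ((n : ℝ) ^ (r + 1) * (ℓ : ℝ) ^ r) * n := by gcongr
    _ ≤ β ^ 2 * ((n : ℝ) ^ (r + 1) * (n : ℝ) ^ r) * n := by gcongr
    _ = β ^ 2 * (n : ℝ) ^ (2 * (r + 1)) := by ring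

lemma le_threshold_of_estimate {est lam τ : ℝ} (hτ : 0 ≤ τ)
    (hest : |est - lam| ≤ 1 / 3 * τ ∨ |est - lam| ≤ 1 / 4 * |lam|) (hlam : lam < 2 / 3 * τ) :
    est ≤ τ := by
  rcases hest with hadd | hmul
  · linarith [(abs_le.1 hadd).2]
  · rcases abs_cases lam with ⟨hlam_abs, -⟩ | ⟨hlam_abs, -⟩ <;>
      linarith [(abs_le.1 hmul).2]

lemma threshold_lt_of_estimate {est lam τ : ℝ} (hτ : 0 ≤ τ)
    (hest : |est - lam| ≤ 1 / 3 * τ ∨ |est - lam| ≤ 1 / 4 * |lam|) (hlam : 4 / 3 * τ < lam) :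
    τ < est := by
  rcases hest with hadd | hmul
  · linarith [(abs_le.1 hadd).1]
  · rw [abs_of_nonneg (by linarith : 0 ≤ lam)] at hmul
    linarith [(abs_le.1 hmul).1]

end Threshold

section Constant

variable (k q : ℕ) [NeZero k]

/-- The constant `C` of the theorem for `p = 2q`. It is chosen so that `(4/3) τ` is at most half the
mean `kikuchiDegree n ℓ q * β * signalStrength k (2q)` of the planted Rayleigh quotient. -/
noncomputable def detectionConst : ℝ :=
  3 / 4 * signalStrength k (2 * q) / ((2 * q : ℕ) ^ q * q !)

variable {k q}

lemma detectionConst_pos (hk : 2 ≤ k) (hq : 1 ≤ q) : 0 < detectionConst k q := by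
  have hM : 0 < signalStrength k (2 * q) := signalStrength_pos hk (even_two_mul q)
  have : 0 < 2 * q := by omega
  unfold detectionConst
  positivity

lemma detectionConst_mul_factorial_le_one (hq : 1 ≤ q) : detectionConst k q * q ! ≤ 1 := by
  have hM := abs_le.1 (abs_signalStrength_le_one (k := k) (p := 2 * q) (by omega))
  have hq' : (1 : ℝ) ≤ (2 * q : ℕ) := by exact_mod_cast (by omega : 1 ≤ 2 * q)
  have hpow : (1 : ℝ) ≤ ((2 * q : ℕ) : ℝ) ^ q := one_le_pow₀ hq'
  have hfac : (q ! : ℝ) ≠ 0 := by exact_mod_cast q.factorial_ne_zero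
  rw [detectionConst, div_mul_eq_mul_div, mul_div_mul_right _ _ hfac,
    div_le_one (by linarith)]
  linarith [hM.2]

lemma four_thirds_threshold_le {n ℓ : ℕ} {β : ℝ} (hk : 2 ≤ k) (hq : 1 ≤ q) (hℓ : q ≤ ℓ)
    (hn : 4 * ℓ ≤ n) (hβ : 0 ≤ β) :
    4 / 3 * threshold (detectionConst k q) n (2 * q) ℓ β ≤
      kikuchiDegree n ℓ q * (β * signalStrength k (2 * q) / 2) := by
  have hM : 0 < signalStrength k (2 * q) := signalStrength_pos hk (even_two_mul q)
  have hconst : (0 : ℝ) < (2 * q : ℕ) ^ q * q ! := by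
    have : 0 < 2 * q := by omega
    positivity
  have hdegree : (n : ℝ) ^ q * (ℓ : ℝ) ^ q / ((2 * q : ℕ) ^ q * q !) ≤ kikuchiDegree n ℓ q := by
    rw [div_le_iff₀' hconst]
    exact_mod_cast pow_mul_pow_le_mul_kikuchiDegree hq hℓ hn
  calc _ = (n : ℝ) ^ q * (ℓ : ℝ) ^ q / ((2 * q : ℕ) ^ q * q !) *
        (β * signalStrength k (2 * q) / 2) := by
        rw [threshold_two_mul, detectionConst]
        ring
    _ ≤ _ := by gcongr

end Constant

section ErrorBounds

variable {n k q ℓ : ℕ} [NeZero k] {θ₀ ε : ℝ}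

lemma nullLaw_real_two_thirds_threshold_le_kikuchiMax_le (hk : 2 ≤ k) (hq : 1 ≤ q) (hℓ : q ≤ ℓ)
    (hn : 4 * ℓ ≤ n) (hε : 0 < ε) (hθ : ε < θ₀) (hθ₀ : θ₀ ≤ 1 / 2)
    (hsnr : 54 * (ℓ * Real.log n) ≤
      (detectionConst k q * snr θ₀ ε) ^ 2 * ((n : ℝ) ^ q * (ℓ : ℝ) ^ q)) :
    (nullLaw n (2 * q) θ₀).real
        {Y | 2 / 3 * threshold (detectionConst k q) n (2 * q) ℓ (snr θ₀ ε) ≤ kikuchiMax ℓ θ₀ Y} ≤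
      Real.exp (-(Real.log n / 2)) := by
  have hτ : 2 / 3 * threshold (detectionConst k q) n (2 * q) ℓ (snr θ₀ ε) =
      detectionConst k q / 3 * snr θ₀ ε * ((n : ℝ) ^ q * (ℓ : ℝ) ^ q) := by
    rw [threshold_two_mul]
    ring
  rw [hτ]
  refine (nullLaw_real_kikuchiMax_ge_le hε hθ hθ₀ (by omega) (by omega) (detectionConst_pos hk hq)
    (detectionConst_mul_factorial_le_one hq) hsnr).trans ?_
  have hℓ1 : (1 : ℝ) ≤ ℓ := by exact_mod_cast hq.trans hℓ
  gcongr
  exact le_mul_of_one_le_left (Real.log_natCast_nonneg n) hℓ1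

variable (k q) in
/-- The constant in the rate `O(1/n)` of the planted error probability. -/
noncomputable def plantedErrorConst : ℝ :=
  4 / signalStrength k (2 * q) ^ 2 *
    (3 * (2 ^ (2 * q) * (2 * q)!) + 4 * ((2 * q : ℕ) : ℝ) ^ 2)

lemma plantedLaw_real_kikuchiMax_le_four_thirds_threshold_le (hk : 2 ≤ k) (hq : 1 ≤ q)
    (hℓ : q ≤ ℓ) (hn : 4 * ℓ ≤ n) (hε : 0 < ε) (hθ : ε < θ₀) (hθ₀ : θ₀ ≤ 1 / 2)
    (hsnr : 54 * (ℓ * Real.log n) ≤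
      (detectionConst k q * snr θ₀ ε) ^ 2 * ((n : ℝ) ^ q * (ℓ : ℝ) ^ q)) :
    (plantedLaw n k (2 * q) θ₀ ε).real
        {Y | kikuchiMax ℓ θ₀ Y ≤ 4 / 3 * threshold (detectionConst k q) n (2 * q) ℓ (snr θ₀ ε)} ≤
      plantedErrorConst k q / n := by
  have hβ : 0 < snr θ₀ ε := snr_pos hε hθ (by linarith)
  have hn' : (0 : ℝ) < n := by exact_mod_cast (by omega : 0 < n)
  have hC : 0 < detectionConst k q := detectionConst_pos hk hq
  have hfac : (1 : ℝ) ≤ q ! := by exact_mod_cast q.factorial_pos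
  have hC' : detectionConst k q ≤ 1 :=
    (le_mul_of_one_le_right hC.le hfac).trans (detectionConst_mul_factorial_le_one hq)
  have hsnr_pow : (n : ℝ) ≤ snr θ₀ ε ^ 2 * (n : ℝ) ^ (2 * q) :=
    le_sq_mul_pow_of_mul_log_le hq (by omega) (by omega) (by omega) hC.le hC' hsnr
  have hd : 0 < kikuchiDegree n ℓ q :=
    Nat.mul_pos (Nat.choose_pos hℓ) (Nat.descFactorial_pos.2 (by omega))
  have hchoose : (n : ℝ) ^ (2 * q) ≤ 2 ^ (2 * q) * (2 * q)! * n.choose (2 * q) := by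
    exact_mod_cast pow_le_mul_choose (by omega)
  have hN : (0 : ℝ) < n.choose (2 * q) := by exact_mod_cast Nat.choose_pos (by omega)
  have hnoise : 3 / (n.choose (2 * q) * snr θ₀ ε ^ 2) ≤ 3 * (2 ^ (2 * q) * (2 * q)!) / n := by
    rw [div_le_div_iff₀ (by positivity) hn']
    calc 3 * (n : ℝ) ≤
          3 * (snr θ₀ ε ^ 2 * (2 ^ (2 * q) * (2 * q)! * n.choose (2 * q))) := by
          gcongr
          exact hsnr_pow.trans (by gcongr)
      _ = _ := by ring
  calc _ ≤ (plantedLaw n k (2 * q) θ₀ ε).real {Y | kikuchiMax ℓ θ₀ Y ≤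
        kikuchiDegree n ℓ q * (snr θ₀ ε * signalStrength k (2 * q) / 2)} :=
        measureReal_mono fun _ hY => le_trans hY (four_thirds_threshold_le hk hq hℓ hn hβ.le)
    _ ≤ 4 / signalStrength k (2 * q) ^ 2 *
        (3 / (n.choose (2 * q) * snr θ₀ ε ^ 2) + 4 * ((2 * q : ℕ) : ℝ) ^ 2 / n) :=
        plantedLaw_real_kikuchiMax_le hk hq (by omega) (by omega) hε hθ hθ₀ hd
    _ ≤ 4 / signalStrength k (2 * q) ^ 2 *
        (3 * (2 ^ (2 * q) * (2 * q)!) / n + 4 * ((2 * q : ℕ) : ℝ) ^ 2 / n) := by gcongr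
    _ = plantedErrorConst k q / n := by
        rw [plantedErrorConst]
        ring

end ErrorBounds

section Asymptotics

lemma eventually_four_mul_le {ℓ : ℕ → ℕ}
    (h : (fun n => (ℓ n : ℝ)) =o[atTop] fun n : ℕ => √(n : ℝ)) :
    ∀ᶠ n in atTop, 4 * ℓ n ≤ n := by
  filter_upwards [h.bound (by norm_num : (0 : ℝ) < 1 / 4), eventually_ge_atTop 1] with n hn hn1
  have hn1' : (1 : ℝ) ≤ n := by exact_mod_cast hn1
  have hsqrt : √(n : ℝ) ≤ n := Real.sqrt_le_iff.2 ⟨by positivity, le_self_pow₀ hn1' two_ne_zero⟩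
  rw [Real.norm_of_nonneg (by positivity), Real.norm_of_nonneg (by positivity)] at hn
  exact_mod_cast (by linarith : (4 : ℝ) * ℓ n ≤ n)

lemma tendsto_measureReal_one_of_eventually_compl_subset {Ω : ℕ → Type*}
    [∀ n, MeasurableSpace (Ω n)] {μ : ∀ n, Measure (Ω n)} [∀ n, IsProbabilityMeasure (μ n)]
    {A B : ∀ n, Set (Ω n)} (hAB : ∀ᶠ n in atTop, (B n)ᶜ ⊆ A n)
    (hB : Tendsto (fun n => (μ n).real (B n)) atTop (𝓝 0)) :
    Tendsto (fun n => (μ n).real (A n)) atTop (𝓝 1) := by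
  have hlower : Tendsto (fun n => 1 - (μ n).real (B n)) atTop (𝓝 1) := by
    simpa using tendsto_const_nhds.sub hB
  refine tendsto_of_tendsto_of_tendsto_of_le_of_le' hlower tendsto_const_nhds ?_
    (Eventually.of_forall fun n => measureReal_le_one)
  filter_upwards [hAB] with n hn
  have hunion : B n ∪ A n = Set.univ :=
    Set.univ_subset_iff.1 (Set.compl_subset_iff_union.1 hn).ge
  have hle := measureReal_union_le (μ := μ n) (B n) (A n)
  rw [hunion, probReal_univ] at hle
  linarith

lemma solvesDetection_of_tendsto {p k : ℕ} [NeZero k] {θ₀ ε : ℕ → ℝ} {ℓ : ℕ → ℕ} {τ : ℕ → ℝ}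
    (hτ : ∀ᶠ n in atTop, 0 ≤ τ n)
    (hnull : Tendsto (fun n => (nullLaw n p (θ₀ n)).real
      {Y | 2 / 3 * τ n ≤ kikuchiMax (ℓ n) (θ₀ n) Y}) atTop (𝓝 0))
    (hplanted : Tendsto (fun n => (plantedLaw n k p (θ₀ n) (ε n)).real
      {Y | kikuchiMax (ℓ n) (θ₀ n) Y ≤ 4 / 3 * τ n}) atTop (𝓝 0))
    {est : ∀ n, Hypergraph n p → ℝ}
    (hest : ∀ᶠ n in atTop, ∀ Y, |est n Y - kikuchiMax (ℓ n) (θ₀ n) Y| ≤ 1 / 3 * τ n ∨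
      |est n Y - kikuchiMax (ℓ n) (θ₀ n) Y| ≤ 1 / 4 * |kikuchiMax (ℓ n) (θ₀ n) Y|) :
    SolvesDetection k p θ₀ ε fun n Y => decide (est n Y ≤ τ n) := by
  constructor
  · refine tendsto_measureReal_one_of_eventually_compl_subset ?_ hnull
    filter_upwards [hest, hτ] with n hestn hτn Y hY
    exact decide_eq_true (le_threshold_of_estimate hτn (hestn Y) (not_le.1 hY))
  · refine tendsto_measureReal_one_of_eventually_compl_subset ?_ hplanted
    filter_upwards [hest, hτ] with n hestn hτn Y hY
    exact decide_eq_false (threshold_lt_of_estimate hτn (hestn Y) (not_le.1 hY)).not_ge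

variable {k q : ℕ} [NeZero k] {θ₀ ε : ℕ → ℝ} {ℓ : ℕ → ℕ}

lemma tendsto_nullLaw_real_two_thirds_threshold_le (hk : 2 ≤ k) (hq : 1 ≤ q)
    (hparam : ∀ᶠ n in atTop, 0 < ε n ∧ ε n < θ₀ n ∧ θ₀ n ≤ 1 / 2)
    (hsize : ∀ᶠ n in atTop, q ≤ ℓ n ∧ 4 * ℓ n ≤ n)
    (hsnr : ∀ᶠ n : ℕ in atTop, 54 * (ℓ n * Real.log n) ≤
      (detectionConst k q * snr (θ₀ n) (ε n)) ^ 2 * ((n : ℝ) ^ q * (ℓ n : ℝ) ^ q)) :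
    Tendsto (fun n => (nullLaw n (2 * q) (θ₀ n)).real
      {Y | 2 / 3 * threshold (detectionConst k q) n (2 * q) (ℓ n) (snr (θ₀ n) (ε n)) ≤
        kikuchiMax (ℓ n) (θ₀ n) Y}) atTop (𝓝 0) := by
  have hrate : Tendsto (fun n : ℕ => Real.exp (-(Real.log n / 2))) atTop (𝓝 0) :=
    Real.tendsto_exp_neg_atTop_nhds_zero.comp
      ((Real.tendsto_log_atTop.comp tendsto_natCast_atTop_atTop).atTop_div_const two_pos)
  refine squeeze_zero' (Eventually.of_forall fun n => measureReal_nonneg) ?_ hrate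
  filter_upwards [hparam, hsize, hsnr] with n ⟨hε, hθ, hθ₀⟩ ⟨hℓ, hn⟩ hsnr_n
  exact nullLaw_real_two_thirds_threshold_le_kikuchiMax_le hk hq hℓ hn hε hθ hθ₀ hsnr_n

lemma tendsto_plantedLaw_real_le_four_thirds_threshold (hk : 2 ≤ k) (hq : 1 ≤ q)
    (hparam : ∀ᶠ n in atTop, 0 < ε n ∧ ε n < θ₀ n ∧ θ₀ n ≤ 1 / 2)
    (hsize : ∀ᶠ n in atTop, q ≤ ℓ n ∧ 4 * ℓ n ≤ n)
    (hsnr : ∀ᶠ n : ℕ in atTop, 54 * (ℓ n * Real.log n) ≤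
      (detectionConst k q * snr (θ₀ n) (ε n)) ^ 2 * ((n : ℝ) ^ q * (ℓ n : ℝ) ^ q)) :
    Tendsto (fun n => (plantedLaw n k (2 * q) (θ₀ n) (ε n)).real
      {Y | kikuchiMax (ℓ n) (θ₀ n) Y ≤
        4 / 3 * threshold (detectionConst k q) n (2 * q) (ℓ n) (snr (θ₀ n) (ε n))})
      atTop (𝓝 0) := by
  refine squeeze_zero' (Eventually.of_forall fun n => measureReal_nonneg) ?_
    (tendsto_const_div_atTop_nhds_zero_nat (plantedErrorConst k q))
  filter_upwards [hparam, hsize, hsnr] with n ⟨hε, hθ, hθ₀⟩ ⟨hℓ, hn⟩ hsnr_n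
  exact plantedLaw_real_kikuchiMax_le_four_thirds_threshold_le hk hq hℓ hn hε hθ hθ₀ hsnr_n

end Asymptotics

end HSBM

theorem mainTheorem1_general (p k : ℕ) (hp : 2 ≤ p) (hpe : Even p) (hk : 2 ≤ k) :
    ∃ C : ℝ, 0 < C ∧
      ∀ (θ₀ ε : ℕ → ℝ) (ℓ : ℕ → ℕ),
        (∀ᶠ n in atTop, 0 < ε n ∧ ε n < θ₀ n ∧ θ₀ n ≤ 1 / 2) →
        (∀ᶠ n in atTop, p ≤ 2 * ℓ n ∧ 4 * ℓ n ≤ n) →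
        (∀ᶠ n : ℕ in atTop,
          3 * √6 / C * (ℓ n : ℝ) ^ ((1 : ℝ) / 2 - (p : ℝ) / 4) * (n : ℝ) ^ (-(p : ℝ) / 4)
            * √(Real.log n) ≤ HSBM.snr (θ₀ n) (ε n)) →
        Tendsto (fun n : ℕ =>
          max
            ((HSBM.nullLaw n p (θ₀ n)).real
              {Y | 2 / 3 * HSBM.threshold C n p (ℓ n) (HSBM.snr (θ₀ n) (ε n))
                ≤ HSBM.kikuchiMax (ℓ n) (θ₀ n) Y})
            ((HSBM.plantedLaw n k p (θ₀ n) (ε n)).real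
              {Y | HSBM.kikuchiMax (ℓ n) (θ₀ n) Y
                ≤ 4 / 3 * HSBM.threshold C n p (ℓ n) (HSBM.snr (θ₀ n) (ε n))}))
          atTop (𝓝 0) ∧
        ∀ est : ∀ n : ℕ, HSBM.Hypergraph n p → ℝ,
          (∀ᶠ n : ℕ in atTop, ∀ Y : HSBM.Hypergraph n p,
            |est n Y - HSBM.kikuchiMax (ℓ n) (θ₀ n) Y|
                ≤ 1 / 3 * HSBM.threshold C n p (ℓ n) (HSBM.snr (θ₀ n) (ε n)) ∨
            |est n Y - HSBM.kikuchiMax (ℓ n) (θ₀ n) Y|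
                ≤ 1 / 4 * |HSBM.kikuchiMax (ℓ n) (θ₀ n) Y|) →
          HSBM.SolvesDetection k p θ₀ ε fun n Y =>
            decide (est n Y ≤ HSBM.threshold C n p (ℓ n) (HSBM.snr (θ₀ n) (ε n))) := by
  obtain ⟨q, rfl⟩ := hpe.two_dvd
  have : NeZero k := ⟨by omega⟩
  have hq : 1 ≤ q := by omega
  have hC : 0 < HSBM.detectionConst k q := HSBM.detectionConst_pos hk hq
  refine ⟨HSBM.detectionConst k q, hC, fun θ₀ ε ℓ hparam hsize hβ => ?_⟩
  have hsize' : ∀ᶠ n in atTop, q ≤ ℓ n ∧ 4 * ℓ n ≤ n :=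
    hsize.mono fun n hn => ⟨by omega, hn.2⟩
  have hsnr : ∀ᶠ n : ℕ in atTop, 54 * (ℓ n * Real.log n) ≤
      (HSBM.detectionConst k q * HSBM.snr (θ₀ n) (ε n)) ^ 2 * ((n : ℝ) ^ q * (ℓ n : ℝ) ^ q) := by
    filter_upwards [hβ, hsize'] with n hβ_n hsize_n
    exact HSBM.mul_log_le_of_snr_ge (by omega) (by omega) hC hβ_n
  have hnull := HSBM.tendsto_nullLaw_real_two_thirds_threshold_le hk hq hparam hsize' hsnr
  have hplanted :=
    HSBM.tendsto_plantedLaw_real_le_four_thirds_threshold hk hq hparam hsize' hsnr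
  refine ⟨by simpa only [max_self] using hnull.max hplanted, fun est hest =>
    HSBM.solvesDetection_of_tendsto ?_ hnull hplanted hest⟩
  filter_upwards [hparam] with n ⟨hε, hθ, hθ₀⟩
  have hsnr_pos : 0 < HSBM.snr (θ₀ n) (ε n) := HSBM.snr_pos hε hθ (by linarith)
  rw [HSBM.threshold_two_mul]
  positivity

theorem mainTheorem1 (p k : ℕ) (hp : 2 ≤ p) (hpe : Even p) (hk : 2 ≤ k) :
    ∃ C : ℝ, 0 < C ∧
      ∀ (θ₀ ε : ℕ → ℝ) (ℓ : ℕ → ℕ), HSBM.ParamConds p θ₀ ε ℓ →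
        (∀ᶠ n : ℕ in atTop,
          3 * √6 / C * (ℓ n : ℝ) ^ ((1 : ℝ) / 2 - (p : ℝ) / 4) * (n : ℝ) ^ (-(p : ℝ) / 4)
            * √(Real.log n) ≤ HSBM.snr (θ₀ n) (ε n)) →
        Tendsto (fun n : ℕ =>
          max
            ((HSBM.nullLaw n p (θ₀ n)).real
              {Y | 2 / 3 * HSBM.threshold C n p (ℓ n) (HSBM.snr (θ₀ n) (ε n))
                ≤ HSBM.kikuchiMax (ℓ n) (θ₀ n) Y})
            ((HSBM.plantedLaw n k p (θ₀ n) (ε n)).real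
              {Y | HSBM.kikuchiMax (ℓ n) (θ₀ n) Y
                ≤ 4 / 3 * HSBM.threshold C n p (ℓ n) (HSBM.snr (θ₀ n) (ε n))}))
          atTop (𝓝 0) ∧
        -- thresholding, at `τ`, any estimate of the largest eigenvalue with additive error at
        -- most `τ / 3` or relative error at most `1 / 4` solves detection
        ∀ est : ∀ n : ℕ, HSBM.Hypergraph n p → ℝ,
          (∀ᶠ n : ℕ in atTop, ∀ Y : HSBM.Hypergraph n p,
            |est n Y - HSBM.kikuchiMax (ℓ n) (θ₀ n) Y|
                ≤ 1 / 3 * HSBM.threshold C n p (ℓ n) (HSBM.snr (θ₀ n) (ε n)) ∨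
            |est n Y - HSBM.kikuchiMax (ℓ n) (θ₀ n) Y|
                ≤ 1 / 4 * |HSBM.kikuchiMax (ℓ n) (θ₀ n) Y|) →
          HSBM.SolvesDetection k p θ₀ ε fun n Y =>
            decide (est n Y ≤ HSBM.threshold C n p (ℓ n) (HSBM.snr (θ₀ n) (ε n))) := by
  obtain ⟨C, hC, h⟩ := mainTheorem1_general p k hp hpe hk
  refine ⟨C, hC, fun θ₀ ε ℓ hP => h θ₀ ε ℓ ?_ ?_⟩
  · filter_upwards [hP.eps_pos, hP.eps_lt, hP.theta_lt] with n hε hθ hθ₀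
    exact ⟨hε, hθ, hθ₀.le⟩
  · filter_upwards [hP.ell_large.eventually_ge_atTop p, HSBM.eventually_four_mul_le hP.ell_small]
      with n hℓ hn
    exact ⟨by omega, hn⟩
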